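/- **Setting.** Let $n\ge 2$, let $\pi=\{\alpha_1,\dots,\alpha_{n-1}\}$, $\alpha_i=\varepsilon_i-\varepsilon_{i+1}$, be the simple roots of $\mathfrak{sl}_n$, $\Delta=\{\varepsilon_x-\varepsilon_y : x\ne y\in[1,n]\}$ its roots, and let $\pi^+,\pi^-\subseteq\pi$ satisfy $\pi^+\cup\pi^-=\pi$ and $\pi^+\cap\pi^-\ne\pi$. Put $$R=(\mathbb N\pi^+\cup-\mathbb N\pi^-)\cap\Delta,\qquad K=\Delta\setminus R,\qquad R_*=(R\cup -R)\setminus R.$$ A root is *nil* if it lies in $K\cup -K$. Let $\mathscr J^\pm$ be the partition of $[1,n]$ into intervals such that $i,i+1$ lie in the same interval iff $\alpha_i\in\pi^\pm$. Objects with superscript $+$ (resp. $-$) are said to be above (resp. below) the line. **Markings.** For each interval $[l,r]$ of $\mathscr J^{\pm}$ and $l\le i\le j$ with $i+j=l+r-1$ there is a half-integer arc above (resp. below) joining the half-integer points $i+\frac12$ and $j+\frac12$; it is trivial if $i=j$. These arcs divide the half-integer points into connected classes (half-integer meanders). On each half-integer meander exactly one arc is marked; if the meander has a trivial arc, the marked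 arc is a trivial one. Marking the half-integer arc $(i+\frac12,j+\frac12)$ marks the integer arc $(i,j+1)$, $j+1=\kappa(i)$, where $\kappa(x)=l+r-x$ on $[l,r]$. **Modified involutions.** Let $[l,r]$ be an interval of $\mathscr J^\pm$ with $m=r-l+1$ points, and let $[u,v]$ be a maximal interval of left ends of marked integer arcs of $[l,r]$. Put $v'=v$ if $2v+1=l+r$ and $v'=v+1$ otherwise, and $X=[u,v']\cup\kappa([u,v'])$. An anti-Toeplitz involution of $X$ is an involution $\sigma$ of $X$ such that (i) $X$ is a single $\langle\kappa,\sigma\rangle$-orbit, which is also a $\langle\kappa\sigma\rangle$-orbit if $v-l+1=\lfloor m/2\rfloor$, and is not a $\langle\kappa\sigma\rangle$-orbit otherwise; (ii) if $\sigma(x)\ne x$, then one of $x,\sigma(x)$ lies in $[u,v']$ and the other in $\kappa([u,v'])$. Let $\sigma^\pm$ be an involution of $[1,n]$ that is an anti-Toeplitz involution on each such $X$ and equals $\kappa$ on the remaining points of each interval of $\mathscr J^\pm$. The directed arcs are $S=\{(x,y):x<y=\sigma^+(x)\}\cup\{(x,y):x>y=\sigma^-(x)\}$; an arc $(x,y)$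 points from $x$ to $y$ and represents $\varepsilon_x-\varepsilon_y$. **Edges.** A non-trivial edge $E$ is a $\langle\sigma^+,\sigma^-\rangle$-orbit with $e=|E|>1$ that is also a $\langle\sigma^+\sigma^-\rangle$-orbit. Choose one of its two end-points (the points of $E$ fixed by $\sigma^+$ or $\sigma^-$) as starting point $a$, and let $\varphi(1)=a,\varphi(2),\dots,\varphi(e)$ be the enumeration of $E$ obtained from $a$ by applying $\sigma^+$ and $\sigma^-$ alternately, first the one not fixing $a$. Put $\beta_i=\varepsilon_{\varphi(i)}-\varepsilon_{\varphi(i+1)}$, and let the $i$-th short arc be the directed arc of $S$ joining $\varphi(i)$ and $\varphi(i+1)$, $1\le i<e$. The turning points are $\varphi(1)$, $\varphi(e)$, and the internal turning points $\varphi(t)$, $1<t<e$, at which $\varphi(t)-\varphi(t-1)$ and $\varphi(t)-\varphi(t+1)$ have opposite signs. A turning point is a source (resp. sink) if all arcs of $S$ meeting it depart from it (resp. arrive at it). **Straightening.** Choose a signature $sg(t)\in\{1,-1\}$ for each internal turning point $\varphi(t)$ with: $sg(t)=1$ if $\beta_t$ is nil; $sg(t)=-1$ if $\beta_{t-1}$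 is nil and $\beta_t$ is not; $sg(t)$ arbitrary if neither is nil. If $sg(t)=1$ (resp. $-1$), the short arc of index $t-1$ (resp. $t$) is deleted; let $z_t=\varphi(t-1)$ (resp. $\varphi(t+1)$) be its end other than $\varphi(t)$. It is replaced by an external arc joining $z_t$ and $\varphi(s)$, directed from $\varphi(s)$ to $z_t$ if $\varphi(t)$ is a source and from $z_t$ to $\varphi(s)$ if $\varphi(t)$ is a sink. Here $\varphi(s)$ is the following turning point of type (source or sink) opposite to that of $\varphi(t)$: if $sg(t)=1$, the first one with $s>t$; if $sg(t)=-1$, the first one with $s>r$, where $\varphi(r)$ is the last internal turning point with $r<t$, of the same type as $\varphi(t)$ and with $sg(r)=-1$, and, if there is no such $r$, the first one of all. The remaining short arcs and the external arcs form the straightened edge $E^*$. **Corollary 8.4.** For every choice made above, and every non-trivial edge $E$, the directed arcs of $E^*$ form a single edge through all the points of $E$ with all arrows aligned, so that $E^*$ has a well-defined starting point $a^*$ and finishing point $b^*$; and the straightened edge value satisfies $$\iota_{E^*}=\varepsilon_{a^*}-\varepsilon_{b^*}\in -K .$$ If moreover $E=E^*$ (the two have the same directed arcs), then $\iota_{E^*}\in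 -K\cap R=-R_*$. -/

import Mathlib

open scoped Pointwise

namespace Biparabolic

/-- The two sides of the horizontal line `L`; `above` is the superscript `+`, `below` is `-`. -/
inductive Side
  | above
  | below

/-- The opposite side. -/
def Side.flip : Side → Side
  | .above => .below
  | .below => .above

/-! ### Roots of `sl_n`

The points of `L` are the integers `1, ..., n`.  Weights are written in the coordinates
`ε_1, ε_2, ...`, that is, as functions `ℤ → ℤ`.  The simple root `α_i = ε_i - ε_{i+1}` is
labelled by `i ∈ [1, n-1]`, and a set of simple roots by the set of its labels.  A pair
`P : Side → Set ℤ` stands for the pair `(π⁺, π⁻) = (P above, P below)`. -/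

/-- The vector `ε_x - ε_y`. -/
def root (x y : ℤ) : ℤ → ℤ := Pi.single x 1 - Pi.single y 1

/-- `Δ`, the set of roots of `sl_n`. -/
def Delta (n : ℕ) : Set (ℤ → ℤ) :=
  {v | ∃ x ∈ Set.Icc (1 : ℤ) n, ∃ y ∈ Set.Icc (1 : ℤ) n, x ≠ y ∧ v = root x y}

/-- The simple roots `α_i` with `i ∈ Q`. -/
def simpleRoots (Q : Set ℤ) : Set (ℤ → ℤ) := (fun i => root i (i + 1)) '' Q

/-- `R = (ℕ π⁺ ∪ -ℕ π⁻) ∩ Δ`. -/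
def R (n : ℕ) (P : Side → Set ℤ) : Set (ℤ → ℤ) :=
  ((AddSubmonoid.closure (simpleRoots (P .above)) : Set (ℤ → ℤ)) ∪
    -(AddSubmonoid.closure (simpleRoots (P .below)) : Set (ℤ → ℤ))) ∩ Delta n

/-- `K = Δ \ R`. -/
def K (n : ℕ) (P : Side → Set ℤ) : Set (ℤ → ℤ) := Delta n \ R n P

/-- `R_* = (R ∪ -R) \ R`. -/
def RStar (n : ℕ) (P : Side → Set ℤ) : Set (ℤ → ℤ) := (R n P ∪ -R n P) \ R n P

/-- A root is nil if it lies in `K ∪ -K`. -/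
def IsNil (n : ℕ) (P : Side → Set ℤ) (v : ℤ → ℤ) : Prop := v ∈ K n P ∪ -K n P

/-! ### The double partition -/

/-- `[l, r]` is a connected component (possibly a single point) of the partition of `[1, n]` into
intervals that corresponds to the set `Q ⊆ [1, n-1]` of simple roots: `i` and `i+1` are in the
same component exactly when `i ∈ Q`. -/
def IsComponent (n : ℕ) (Q : Set ℤ) (l r : ℤ) : Prop :=
  1 ≤ l ∧ l ≤ r ∧ r ≤ n ∧ (∀ i, l ≤ i → i < r → i ∈ Q) ∧ l - 1 ∉ Q ∧ r ∉ Q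

/-! ### Half-integer arcs and their markings

The simple root `α_i` is the half-integer point `i + 1/2` of `L`. -/

/-- The (non-fictitious) half-integer arc joining `i + 1/2` and `j + 1/2`, `i ≤ j`, on the side
where the set of simple roots is `Q`: `α_i` and `α_j` are exchanged by the Dynkin diagram involution
of the connected component `{α_l, ..., α_{r-1}}` of `Q`.  For `i = j` this is the trivial arc at a
fixed point of that involution. -/
def IsHalfArc (n : ℕ) (Q : Set ℤ) (i j : ℤ) : Prop :=
  ∃ l r, IsComponent n Q l r ∧ l ≤ i ∧ i ≤ j ∧ i + j = l + r - 1

/-- `α_i` and `α_j` lie on the same half-integer meander.  Fictitious arcs need not be mentioned: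
they only join points of a path of non-fictitious arcs to one another (directly or through an
additional point), or an end of such a path to itself. -/
def SameHalfMeander (n : ℕ) (P : Side → Set ℤ) : ℤ → ℤ → Prop :=
  Relation.EqvGen fun i j => ∃ s, IsHalfArc n (P s) i j

/-- `M s` is the set of the marked half-integer arcs on side `s`.  Exactly one non-fictitious arc
is marked on every half-integer meander; if the meander is an edge, that is, if it has a
non-fictitious trivial arc, then the marked arc is a trivial one. (A meander with no non-fictitious
trivial arc is a loop, possibly closed up by fictitious arcs.) -/
structure IsMarking (n : ℕ) (P : Side → Set ℤ) (M : Side → Set (ℤ × ℤ)) : Prop where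
  isHalfArc : ∀ s i j, (i, j) ∈ M s → IsHalfArc n (P s) i j
  existsUnique : ∀ k ∈ Set.Icc (1 : ℤ) (n - 1),
    ∃! q : Side × ℤ × ℤ, q.2 ∈ M q.1 ∧ SameHalfMeander n P k q.2.1
  trivial_of_edge : ∀ s i j, (i, j) ∈ M s →
    (∃ s' k, IsHalfArc n (P s') k k ∧ SameHalfMeander n P i k) → i = j

/-! ### Meanders, loops, edges -/

/-- A meander: an orbit of the group `⟨f, g⟩` generated by two involutions. -/
def IsMeander (f g : Equiv.Perm ℤ) (E : Set ℤ) : Prop :=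
  ∃ x, E = MulAction.orbit (Subgroup.closure {f, g}) x

/-- An edge: a `⟨f, g⟩`-orbit that is also a `⟨f g⟩`-orbit. -/
def IsEdge (f g : Equiv.Perm ℤ) (E : Set ℤ) : Prop :=
  ∃ x, E = MulAction.orbit (Subgroup.closure {f, g}) x ∧
    E = MulAction.orbit (Subgroup.zpowers (f * g)) x

/-- A loop: a meander that is not an edge. -/
def IsLoop (f g : Equiv.Perm ℤ) (E : Set ℤ) : Prop := IsMeander f g E ∧ ¬ IsEdge f g E

/-! ### Anti-Toeplitz involutions and the modified involutions

In a component `[l, r]` the unmodified involution `κ` is `x ↦ l + r - x`.  A half-integer arc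
joining `i + 1/2` to `j + 1/2` (`i + j = l + r - 1`) marks the unmodified integer arc joining
`i` to `κ(i) = j + 1`. -/

/-- The unmodified integer arc joining `i < κ(i) = l + r - i` in the component `[l, r]` is marked. -/
def IsMarkedArc (M : Set (ℤ × ℤ)) (l r i : ℤ) : Prop := (i, l + r - 1 - i) ∈ M

/-- `[u, v]` is a connected component of the set of the left ends of the marked integer arcs of the
component `[l, r]`. -/
def IsMarkedRun (M : Set (ℤ × ℤ)) (l r u v : ℤ) : Prop :=
  l ≤ u ∧ u ≤ v ∧ (∀ i, u ≤ i → i ≤ v → IsMarkedArc M l r i) ∧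
    ¬ IsMarkedArc M l r (u - 1) ∧ ¬ IsMarkedArc M l r (v + 1)

/-- The left half of the extended component of a marked run `[u, v]`: it is `[u, v + 1]`, except
that it is `[u, v]` when `v` and `κ(v) = v + 1` are the two middle points of `[l, r]`. -/
def leftHalf (l r u v : ℤ) : Set ℤ := Set.Icc u (if 2 * v + 1 = l + r then v else v + 1)

/-- The right half, the image of the left half under `κ`. -/
def rightHalf (l r u v : ℤ) : Set ℤ := (fun x => l + r - x) '' leftHalf l r u v

/-- The extended component of a marked run. -/
def extendedComponent (l r u v : ℤ) : Set ℤ := leftHalf l r u v ∪ rightHalf l r u v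

/-- The marked run `[u, v]` reaches the centre of `[l, r]`: its last element is the last of the
`⌊(r - l + 1) / 2⌋` left ends of non-trivial arcs of `κ`. -/
def IsCentralRun (l r v : ℤ) : Prop := v - l + 1 = (r - l + 1) / 2

/-- `τ` acts on the extended component of the marked run `[u, v]` of `[l, r]` as an anti-Toeplitz
involution. (The first two conditions force the extended component to be stable under `τ`.) -/
structure IsAntiToeplitz (τ : Equiv.Perm ℤ) (l r u v : ℤ) : Prop where
  loop : ¬ IsCentralRun l r v → IsLoop (Equiv.subLeft (l + r)) τ (extendedComponent l r u v)
  edge : IsCentralRun l r v → IsEdge (Equiv.subLeft (l + r)) τ (extendedComponent l r u v)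
  opposite : ∀ x ∈ extendedComponent l r u v, τ x ≠ x →
    (x ∈ leftHalf l r u v ∧ τ x ∈ rightHalf l r u v) ∨
    (τ x ∈ leftHalf l r u v ∧ x ∈ rightHalf l r u v)

/-- `τ` is a modified involution of `[1, n]` for the partition given by `Q` and the set `M` of marked
half-integer arcs: in each component `[l, r]` it is an anti-Toeplitz involution on every extended
component of the set of markings, and it is `x ↦ l + r - x` elsewhere. -/
structure IsModifiedInvolution (n : ℕ) (Q : Set ℤ) (M : Set (ℤ × ℤ)) (τ : Equiv.Perm ℤ) : Prop where
  involutive : Function.Involutive τ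
  outside : ∀ x, x ∉ Set.Icc (1 : ℤ) n → τ x = x
  antiToeplitz : ∀ l r u v, IsComponent n Q l r → IsMarkedRun M l r u v → IsAntiToeplitz τ l r u v
  unmodified : ∀ l r, IsComponent n Q l r → ∀ x ∈ Set.Icc l r,
    (∀ u v, IsMarkedRun M l r u v → x ∉ extendedComponent l r u v) → τ x = l + r - x

/-! ### Directed arcs of an edge

From now on `σ above`, `σ below` are the two modified involutions.  A directed arc from `x` to `y`
is the pair `(x, y)`; it represents the root `ε_x - ε_y`. -/

/-- The directed arcs `S = S⁺ ∪ S⁻`: the non-trivial arcs of `σ above`, pointing from left to right,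
and those of `σ below`, pointing from right to left. -/
def S (σ : Side → Equiv.Perm ℤ) : Set (ℤ × ℤ) :=
  {p | p.1 < p.2 ∧ σ .above p.1 = p.2} ∪ {p | p.2 < p.1 ∧ σ .below p.1 = p.2}

/-- The directed arcs of `S` between points of the edge `E`. -/
def edgeArcs (σ : Side → Equiv.Perm ℤ) (E : Set ℤ) : Set (ℤ × ℤ) :=
  {p ∈ S σ | p.1 ∈ E ∧ p.2 ∈ E}

/-- `a` is one of the two end-points of the non-trivial edge `E`. -/
def IsEdgeEnd (σ : Side → Equiv.Perm ℤ) (E : Set ℤ) (a : ℤ) : Prop :=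
  a ∈ E ∧ ∃ s, σ s a = a

open Classical in
/-- The side of the arc joining `φ(t)` to `φ(t+1)` on the edge starting at `a`, `t ≥ 1`; sides
alternate, and the first arc is on the side whose involution does not fix `a`. -/
noncomputable def arcSide (σ : Side → Equiv.Perm ℤ) (a : ℤ) : ℕ → Side
  | 0 => if σ .above a = a then .above else .below
  | t + 1 => (arcSide σ a t).flip

/-- The enumeration `φ(1) = a, φ(2), ..., φ(e)` of the edge starting at `a` (the value at `0` is
not used). -/
noncomputable def phi (σ : Side → Equiv.Perm ℤ) (a : ℤ) : ℕ → ℤ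
  | 0 => a
  | 1 => a
  | t + 2 => σ (arcSide σ a (t + 1)) (phi σ a (t + 1))

section Straightening

variable (n : ℕ) (P : Side → Set ℤ) (σ : Side → Equiv.Perm ℤ) (a : ℤ) (e : ℕ) (sg : ℕ → ℤ)

/-- `φ(t)` is an internal turning point of the edge. -/
def IsInternalTurning (t : ℕ) : Prop :=
  1 < t ∧ t < e ∧ (phi σ a t - phi σ a (t - 1)) * (phi σ a t - phi σ a (t + 1)) < 0

/-- `φ(t)` is a turning point of the edge: an end-point or an internal turning point. -/
def IsTurning (t : ℕ) : Prop := t = 1 ∨ t = e ∨ IsInternalTurning σ a e t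

/-- `φ(t)` is a source (type `A`): a turning point at which no arc of `S` arrives. -/
def IsSource (t : ℕ) : Prop := IsTurning σ a e t ∧ ∀ y, (y, phi σ a t) ∉ S σ

/-- `φ(t)` is a sink (type `B`): a turning point from which no arc of `S` departs. -/
def IsSink (t : ℕ) : Prop := IsTurning σ a e t ∧ ∀ y, (phi σ a t, y) ∉ S σ

/-- `β_t = ε_{φ(t)} - ε_{φ(t+1)}`. -/
noncomputable def beta (t : ℕ) : ℤ → ℤ := root (phi σ a t) (phi σ a (t + 1))

/-- The rule for the signature `sg` at the internal turning points `φ(t)`: `sg t = 1` means that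
the boundary value assigned to `φ(t)` and marked is `β_{t-1}`, and `sg t = -1` that it is `β_t`.
If exactly one of the two is nil, the other one is marked; if both are nil, `β_{t-1}` is marked;
if neither is nil, the choice is free. -/
def IsSignature : Prop :=
  ∀ t, IsInternalTurning σ a e t →
    (sg t = 1 ∨ sg t = -1) ∧
    (IsNil n P (beta σ a (t - 1)) → IsNil n P (beta σ a t) → sg t = 1) ∧
    (IsNil n P (beta σ a (t - 1)) → ¬ IsNil n P (beta σ a t) → sg t = -1) ∧
    (¬ IsNil n P (beta σ a (t - 1)) → IsNil n P (beta σ a t) → sg t = 1)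

/-- `β_i` is marked. -/
def IsMarkedValue (i : ℕ) : Prop :=
  ∃ t, IsInternalTurning σ a e t ∧ ((sg t = 1 ∧ i + 1 = t) ∨ (sg t = -1 ∧ i = t))

/-- `φ(s)` is the turning point crossed by the external arc assigned to the internal turning point
`φ(t)`.  Here `same` is the type (source or sink) of `φ(t)` and `opp` is the opposite type.
If `sg t = 1`, it is the first turning point of opposite type after `φ(t)`.  If `sg t = -1`, it is
the first turning point of opposite type after the last internal turning point `φ(r)`, `r < t`, of
the same type and of negative signature, and, if there is no such `φ(r)`, the first turning point
of opposite type. -/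
def Crosses (same opp : ℕ → Prop) (t s : ℕ) : Prop :=
  (sg t = 1 ∧ IsLeast {s | opp s ∧ t < s} s) ∨
  (sg t = -1 ∧
    IsLeast {s | opp s ∧ ∀ r < t, IsInternalTurning σ a e r → same r → sg r = -1 → r < s} s)

/-- The index of the end-point other than `φ(t)` of the marked short line assigned to `φ(t)`. -/
def otherEnd (t : ℕ) : ℕ := if sg t = 1 then t - 1 else t + 1

/-- The directed external arcs.  The one assigned to an internal turning point `φ(t)` joins the other
end of the deleted short line to the turning point crossed, with the arrow at the other end
pointing as on the deleted line: towards it if `φ(t)` is a source, away from it if `φ(t)` is a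
sink. -/
def externalArcs : Set (ℤ × ℤ) :=
  {p | ∃ t s, IsInternalTurning σ a e t ∧
    ((IsSource σ a e t ∧ Crosses σ a e sg (IsSource σ a e) (IsSink σ a e) t s ∧
        p = (phi σ a s, phi σ a (otherEnd sg t))) ∨
     (IsSink σ a e t ∧ Crosses σ a e sg (IsSink σ a e) (IsSource σ a e) t s ∧
        p = (phi σ a (otherEnd sg t), phi σ a s)))}

/-- The short directed arcs `ε_i β_i ∈ S` that are not marked. -/
def unmarkedArcs : Set (ℤ × ℤ) :=
  {p ∈ S σ | ∃ i, 1 ≤ i ∧ i < e ∧ ¬ IsMarkedValue σ a e sg i ∧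
    (p = (phi σ a i, phi σ a (i + 1)) ∨ p = (phi σ a (i + 1), phi σ a i))}

/-- The directed arcs of the straightened edge `E^*`; they represent the roots `β_i^*`. -/
def straightenedArcs : Set (ℤ × ℤ) := unmarkedArcs σ a e sg ∪ externalArcs σ a e sg

end Straightening

/-- The set `A` of directed arcs forms a single edge passing through all the points of `V`, with all
its arrows aligned, with starting point `x` and finishing point `y`. -/
def IsAlignedEdge (A : Set (ℤ × ℤ)) (V : Set ℤ) (x y : ℤ) : Prop :=
  ∃ (p : ℕ) (ψ : ℕ → ℤ), 2 ≤ p ∧ Set.InjOn ψ (Set.Icc 1 p) ∧ ψ '' Set.Icc 1 p = V ∧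
    A = {q | ∃ j, 1 ≤ j ∧ j < p ∧ q = (ψ j, ψ (j + 1))} ∧ ψ 1 = x ∧ ψ p = y

end Biparabolic

/-!
Every arc of `S` represents a root of `R`, and `R` is a transitive relation on points. The
straightened edge is built along `E`, one turning point at a time: when the signature is positive
the new piece of the edge is inserted in place of the deleted arc, when it is negative the new piece
is put in front. This gives a directed path from a source `a^*` of `E` to a sink `b^*`, through all
the points of `E`.

Then `ε_{a^*} - ε_{b^*} ∈ -K` unless `ε_{b^*} - ε_{a^*} ∈ R`. At a source the centre of the
component below is not to the right of the centre of the component above, at a sink it is not to the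
left, and the two can only agree at a fixed point. So if `ε_{b^*} - ε_{a^*}` were in `R`, then `a^*`
and `b^*` would be the end-points of `E` and would lie in the same two components, which would be
concentric. Counting points of `E` modulo 2 gives a height function on the half-integer points that
is constant on half-integer meanders: an arc that is not marked preserves it, and removing the
marked arc does not disconnect a meander. So `E` is stable under both unmodified involutions, and
the modified involutions on the extended components then force `E = [1, n]`. Any further component
would have no fixed points, hence an even number of points and a trivial half-integer arc away from
the centre, and there is none. So `π^+ = π^- = π`, against the hypothesis.
-/

namespace Biparabolic

/-! ### Components and roots -/

section Components

variable {n : ℕ} {Q : Set ℤ} {l r x y : ℤ}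

/-- All the simple roots between the points `x` and `y` lie in `Q`; for `x < y` this says that `x`
and `y` are in the same component of the partition given by `Q`. It holds vacuously if `y ≤ x`. -/
def Linked (Q : Set ℤ) (x y : ℤ) : Prop := ∀ i, x ≤ i → i < y → i ∈ Q

lemma Linked.trans {z : ℤ} (hxy : Linked Q x y) (hyz : Linked Q y z) : Linked Q x z :=
  fun i hx hz => (lt_or_ge i y).elim (hxy i hx) (hyz i · hz)

lemma Linked.mono {x' y' : ℤ} (h : Linked Q x y) (hx : x ≤ x') (hy : y' ≤ y) : Linked Q x' y' :=
  fun i h₁ h₂ => h i (hx.trans h₁) (h₂.trans_le hy)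

lemma IsComponent.linked (h : IsComponent n Q l r) : Linked Q l r := h.2.2.2.1

lemma IsComponent.le_of_linked (h : IsComponent n Q l r) (hx : x ≤ r) (hxy : Linked Q x y) :
    y ≤ r := by
  by_contra! hy
  exact h.2.2.2.2.2 (hxy r hx hy)

lemma IsComponent.ge_of_linked (h : IsComponent n Q l r) (hy : l ≤ y) (hxy : Linked Q x y) :
    l ≤ x := by
  by_contra! hx
  exact h.2.2.2.2.1 (hxy (l - 1) (by lia) (by lia))

lemma IsComponent.eq_of_mem {l' r' : ℤ} (h : IsComponent n Q l r) (h' : IsComponent n Q l' r')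
    (hx : x ∈ Set.Icc l r) (hx' : x ∈ Set.Icc l' r') : l = l' ∧ r = r' :=
  ⟨le_antisymm (h.ge_of_linked hx.1 (h'.linked.mono le_rfl hx'.2))
      (h'.ge_of_linked hx'.1 (h.linked.mono le_rfl hx.2)),
    le_antisymm (h'.le_of_linked hx'.2 (h.linked.mono hx.1 le_rfl))
      (h.le_of_linked hx.2 (h'.linked.mono hx'.1 le_rfl))⟩

lemma IsComponent.eq_of_add_eq {l' r' : ℤ} (h : IsComponent n Q l r) (h' : IsComponent n Q l' r')
    (hs : l + r = l' + r') : l = l' ∧ r = r' := by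
  have hlr := h.2.1
  have hlr' := h'.2.1
  exact h.eq_of_mem h' (x := max l l') (by constructor <;> lia) (by constructor <;> lia)

lemma exists_isComponent (hQ : Q ⊆ Set.Icc (1 : ℤ) (n - 1)) (hx : x ∈ Set.Icc (1 : ℤ) n) :
    ∃ l r, IsComponent n Q l r ∧ x ∈ Set.Icc l r := by
  have h0 : (0 : ℤ) ∉ Q := fun h => by simpa using (hQ h).1
  have hn : (n : ℤ) ∉ Q := fun h => by simpa using (hQ h).2
  obtain ⟨hx1, hxn⟩ := hx
  obtain ⟨l, ⟨hl, hlQ⟩, hl_max⟩ := Int.exists_greatest_of_bdd (P := fun i => i < x ∧ i ∉ Q)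
    ⟨x, fun z hz => hz.1.le⟩ ⟨0, by lia, h0⟩
  obtain ⟨r, ⟨hr, hrQ⟩, hr_min⟩ := Int.exists_least_of_bdd (P := fun i => x ≤ i ∧ i ∉ Q)
    ⟨x, fun z hz => hz.1⟩ ⟨n, hxn, hn⟩
  have hl0 : 0 ≤ l := hl_max 0 ⟨by lia, h0⟩
  refine ⟨l + 1, r, ⟨by lia, by lia, hr_min n ⟨hxn, hn⟩, fun i hli hir => ?_, by simpa using hlQ,
    hrQ⟩, by lia, hr⟩
  by_contra hi
  rcases lt_or_ge i x with h | h
  · have := hl_max i ⟨h, hi⟩; lia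
  · have := hr_min i ⟨h, hi⟩; lia

end Components

section Roots

variable {n : ℕ} {P : Side → Set ℤ} {Q : Set ℤ} {x y : ℤ}

/-- The relation `ε_x - ε_y ∈ R` between distinct points `x`, `y`, in terms of the partitions. -/
def RRel (P : Side → Set ℤ) (x y : ℤ) : Prop :=
  (x < y ∧ Linked (P .above) x y) ∨ (y < x ∧ Linked (P .below) y x)

lemma RRel.trans {z : ℤ} (h : RRel P x y) (h' : RRel P y z) (hxz : x ≠ z) : RRel P x z := by
  rcases h with ⟨hxy, h⟩ | ⟨hyx, h⟩ <;> rcases h' with ⟨hyz, h'⟩ | ⟨hzy, h'⟩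
  · exact .inl ⟨hxy.trans hyz, h.trans h'⟩
  · rcases lt_or_gt_of_ne hxz with hlt | hgt
    · exact .inl ⟨hlt, h.mono le_rfl hzy.le⟩
    · exact .inr ⟨hgt, h'.mono le_rfl hxy.le⟩
  · rcases lt_or_gt_of_ne hxz with hlt | hgt
    · exact .inl ⟨hlt, h'.mono hyx.le le_rfl⟩
    · exact .inr ⟨hgt, h.mono hyz.le le_rfl⟩
  · exact .inr ⟨hzy.trans hyx, h'.trans h⟩

lemma neg_root (x y : ℤ) : -root x y = root y x := by simp [root]

lemma sum_Icc_root (k : ℤ) (hx : 1 ≤ x) (hy : 1 ≤ y) :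
    ∑ i ∈ Finset.Icc 1 k, root x y i = (if x ≤ k then 1 else 0) - (if y ≤ k then 1 else 0) := by
  simp only [root, Pi.sub_apply, Finset.sum_sub_distrib, Pi.single_apply, Finset.sum_ite_eq',
    Finset.mem_Icc, hx, hy, true_and]

/-- The partial sum up to `k` is the coefficient of `α_k`. -/
lemma sum_Icc_of_mem_closure (hQ : ∀ i ∈ Q, 1 ≤ i) {v : ℤ → ℤ}
    (hv : v ∈ AddSubmonoid.closure (simpleRoots Q)) (k : ℤ) :
    0 ≤ ∑ i ∈ Finset.Icc 1 k, v i ∧ (k ∉ Q → ∑ i ∈ Finset.Icc 1 k, v i = 0) := by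
  induction hv using AddSubmonoid.closure_induction with
  | mem v hv =>
    obtain ⟨i, hi, rfl⟩ := hv
    have h1 := hQ i hi
    simp only
    rw [sum_Icc_root k h1 (by lia)]
    refine ⟨by split_ifs <;> lia, fun hk => ?_⟩
    have : i ≠ k := fun h => hk (h ▸ hi)
    split_ifs <;> lia
  | zero => simp
  | add u v _ _ hu hv =>
    simp only [Pi.add_apply, Finset.sum_add_distrib]
    exact ⟨add_nonneg hu.1 hv.1, fun hk => by rw [hu.2 hk, hv.2 hk, add_zero]⟩

lemma root_mem_closure_of_linked (hxy : x < y) (h : Linked Q x y) :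
    root x y ∈ AddSubmonoid.closure (simpleRoots Q) := by
  revert h
  induction y, hxy using Int.leInduction with
  | base => exact fun h => AddSubmonoid.subset_closure ⟨x, h x le_rfl (by lia), rfl⟩
  | succ y hxy ih =>
    intro h
    have hadd : root x (y + 1) = root x y + root y (y + 1) := by simp [root]
    rw [hadd]
    exact add_mem (ih (h.mono le_rfl (by lia)))
      (AddSubmonoid.subset_closure ⟨y, h y (by lia) (by lia), rfl⟩)

lemma root_mem_closure_iff (hQ : ∀ i ∈ Q, 1 ≤ i) (hx : 1 ≤ x) (hy : 1 ≤ y) (hxy : x ≠ y) :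
    root x y ∈ AddSubmonoid.closure (simpleRoots Q) ↔ x < y ∧ Linked Q x y := by
  refine ⟨fun h => ?_, fun h => root_mem_closure_of_linked h.1 h.2⟩
  have hsum := sum_Icc_of_mem_closure hQ h
  simp only [sum_Icc_root _ hx hy] at hsum
  have hlt : x < y := by
    by_contra! hle
    have := (hsum y).1
    rw [if_neg (by lia), if_pos le_rfl] at this
    lia
  refine ⟨hlt, fun i hi hi' => ?_⟩
  by_contra hiQ
  have := (hsum i).2 hiQ
  rw [if_pos hi, if_neg (by lia)] at this
  lia

lemma root_mem_Delta (hx : x ∈ Set.Icc (1 : ℤ) n) (hy : y ∈ Set.Icc (1 : ℤ) n) (hxy : x ≠ y) :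
    root x y ∈ Delta n := ⟨x, hx, y, hy, hxy, rfl⟩

lemma root_mem_R_iff (hQ : ∀ s, P s ⊆ Set.Icc (1 : ℤ) (n - 1)) (hx : x ∈ Set.Icc (1 : ℤ) n)
    (hy : y ∈ Set.Icc (1 : ℤ) n) (hxy : x ≠ y) : root x y ∈ R n P ↔ RRel P x y := by
  rw [R, Set.mem_inter_iff, and_iff_left (root_mem_Delta hx hy hxy), Set.mem_union, Set.mem_neg,
    neg_root, SetLike.mem_coe, SetLike.mem_coe,
    root_mem_closure_iff (fun i hi => (hQ _ hi).1) hx.1 hy.1 hxy,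
    root_mem_closure_iff (fun i hi => (hQ _ hi).1) hy.1 hx.1 hxy.symm, RRel]

lemma root_mem_neg_K_iff (hQ : ∀ s, P s ⊆ Set.Icc (1 : ℤ) (n - 1)) (hx : x ∈ Set.Icc (1 : ℤ) n)
    (hy : y ∈ Set.Icc (1 : ℤ) n) (hxy : x ≠ y) : root x y ∈ -K n P ↔ ¬ RRel P y x := by
  rw [Set.mem_neg, neg_root, K, Set.mem_sdiff, root_mem_R_iff hQ hy hx hxy.symm]
  exact and_iff_right (root_mem_Delta hy hx hxy.symm)

lemma isNil_root_iff (hQ : ∀ s, P s ⊆ Set.Icc (1 : ℤ) (n - 1)) (hx : x ∈ Set.Icc (1 : ℤ) n)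
    (hy : y ∈ Set.Icc (1 : ℤ) n) (hxy : x ≠ y) :
    IsNil n P (root x y) ↔ ¬ (RRel P x y ∧ RRel P y x) := by
  rw [IsNil, Set.mem_union, root_mem_neg_K_iff hQ hx hy hxy, K, Set.mem_sdiff,
    root_mem_R_iff hQ hx hy hxy, and_iff_right (root_mem_Delta hx hy hxy)]
  tauto

lemma neg_K_inter_R (n : ℕ) (P : Side → Set ℤ) : -K n P ∩ R n P = -RStar n P := by
  have hR : ∀ v ∈ R n P, -v ∈ Delta n := by
    rintro v ⟨-, x, hx, y, hy, hxy, rfl⟩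
    rw [neg_root]
    exact root_mem_Delta hy hx hxy.symm
  ext v
  simp only [K, RStar, Set.mem_inter_iff, Set.mem_neg, Set.mem_sdiff, Set.mem_union, neg_neg]
  have := hR v
  tauto

end Roots

/-! ### Involutions -/

section Involutions

variable {α : Type*}

/-- The points that an involution moves come in pairs. -/
lemma ncard_eq_ncard_fixed {τ : α → α} (hτ : Function.Involutive τ) {A : Set α} (hA : A.Finite)
    (hτA : ∀ x ∈ A, τ x ∈ A) : (A.ncard : ZMod 2) = {x ∈ A | τ x = x}.ncard := by
  classical
  lift A to Finset α using hA
  have hmoved : ∑ x ∈ A with τ x ≠ x, (1 : ZMod 2) = 0 :=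
    Finset.sum_involution (fun x _ => τ x) (fun _ _ => by decide)
      (fun x hx _ => (Finset.mem_filter.1 hx).2)
      (fun x hx => by
        simp only [Finset.mem_filter, hτ x] at hx ⊢
        exact ⟨hτA x hx.1, hx.2.symm⟩)
      (fun x _ => hτ x)
  have hfixed : {x ∈ (A : Set α) | τ x = x} = ({x ∈ A | τ x = x} : Finset α) := by simp
  rw [hfixed, Set.ncard_coe_finset, Set.ncard_coe_finset,
    ← Finset.card_filter_add_card_filter_not (s := A) (fun x => τ x = x)]
  simpa using hmoved

lemma apply_mem_iff_of_involutive {τ : α → α} (hτ : Function.Involutive τ) {A : Set α}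
    (hτA : ∀ x ∈ A, τ x ∈ A) (x : α) : τ x ∈ A ↔ x ∈ A :=
  ⟨fun h => hτ x ▸ hτA _ h, hτA x⟩

lemma orbit_closure_subset {G : Type*} [Group G] [MulAction G α] {s : Set G} {A : Set α}
    (hs : ∀ g ∈ s, ∀ x, g • x ∈ A ↔ x ∈ A) {x : α} (hx : x ∈ A) :
    MulAction.orbit (Subgroup.closure s) x ⊆ A := by
  rintro _ ⟨⟨k, hk⟩, rfl⟩
  have hle : Subgroup.closure s ≤ MulAction.stabilizer G A :=
    (Subgroup.closure_le _).2 fun g hg => MulAction.mem_stabilizer_set.2 (hs g hg)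
  exact (MulAction.mem_stabilizer_set.1 (hle hk) x).2 hx

variable {f g : Equiv.Perm α} {x y : α}

lemma orbit_closure_pair_subset (hf : Function.Involutive f) (hg : Function.Involutive g)
    {A : Set α} (hfA : ∀ y ∈ A, f y ∈ A) (hgA : ∀ y ∈ A, g y ∈ A) (hx : x ∈ A) :
    MulAction.orbit (Subgroup.closure {f, g}) x ⊆ A := by
  refine orbit_closure_subset (fun k hk => ?_) hx
  rcases hk with rfl | rfl
  exacts [apply_mem_iff_of_involutive hf hfA, apply_mem_iff_of_involutive hg hgA]

lemma mul_inv_of_involutive (hf : Function.Involutive f) (hg : Function.Involutive g) :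
    (f * g)⁻¹ = g * f := by
  rw [mul_inv_rev]
  exact congrArg₂ (· * ·) (Function.Involutive.symm_eq_self_of_involutive g hg)
    (Function.Involutive.symm_eq_self_of_involutive f hf)

lemma left_apply_zpow (hf : Function.Involutive f) (hg : Function.Involutive g) (k : ℤ) (y : α) :
    f (((f * g) ^ k) y) = ((f * g) ^ (-k)) (f y) := by
  have hconj : SemiconjBy f (f * g) (f * g)⁻¹ := by
    rw [SemiconjBy, mul_inv_of_involutive hf hg]
    ext z
    simp [hf z, hf (g z)]
  have := (hconj.zpow_right k).eq
  rw [inv_zpow'] at this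
  exact DFunLike.congr_fun this y

lemma right_apply_zpow (hf : Function.Involutive f) (hg : Function.Involutive g) (k : ℤ) (y : α) :
    g (((f * g) ^ k) y) = ((f * g) ^ (-k)) (g y) := by
  have := left_apply_zpow hg hf (-k) y
  rwa [← mul_inv_of_involutive hf hg, inv_zpow', inv_zpow', neg_neg] at this

lemma right_apply_zpow_eq_left (hf : Function.Involutive f) (k : ℤ) (y : α) :
    g (((f * g) ^ k) y) = f (((f * g) ^ (1 + k)) y) := by
  rw [zpow_one_add, Equiv.Perm.mul_apply (f * g), Equiv.Perm.mul_apply f, hf]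

lemma mem_orbit_zpowers {ρ : Equiv.Perm α} :
    y ∈ MulAction.orbit (Subgroup.zpowers ρ) x ↔ ∃ k : ℤ, (ρ ^ k) x = y := by
  simp [MulAction.mem_orbit_iff, Subgroup.smul_def]

lemma orbit_closure_pair_eq_of_fixed_left (hf : Function.Involutive f)
    (hg : Function.Involutive g) (hy : f y = y) :
    MulAction.orbit (Subgroup.closure {f, g}) y = MulAction.orbit (Subgroup.zpowers (f * g)) y := by
  have hfρ (k : ℤ) : f (((f * g) ^ k) y) = ((f * g) ^ (-k)) y := by
    rw [left_apply_zpow hf hg, hy]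
  refine Set.Subset.antisymm (orbit_closure_pair_subset hf hg ?_ ?_ (MulAction.mem_orbit_self y)) ?_
  · intro z hz
    obtain ⟨k, rfl⟩ := mem_orbit_zpowers.1 hz
    exact mem_orbit_zpowers.2 ⟨-k, (hfρ k).symm⟩
  · intro z hz
    obtain ⟨k, rfl⟩ := mem_orbit_zpowers.1 hz
    refine mem_orbit_zpowers.2 ⟨-(1 + k), ?_⟩
    rw [right_apply_zpow_eq_left hf, hfρ]
  · have hle : Subgroup.zpowers (f * g) ≤ Subgroup.closure {f, g} := Subgroup.zpowers_le.2
      (mul_mem (Subgroup.subset_closure (by simp)) (Subgroup.subset_closure (by simp)))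
    rintro _ ⟨⟨k, hk⟩, rfl⟩
    exact ⟨⟨k, hle hk⟩, rfl⟩

lemma orbit_closure_pair_eq_of_fixed (hf : Function.Involutive f) (hg : Function.Involutive g)
    (hy : f y = y ∨ g y = y) :
    MulAction.orbit (Subgroup.closure {f, g}) y = MulAction.orbit (Subgroup.zpowers (f * g)) y := by
  rcases hy with hy | hy
  · exact orbit_closure_pair_eq_of_fixed_left hf hg hy
  · rw [Set.pair_comm, orbit_closure_pair_eq_of_fixed_left hg hf hy, ← mul_inv_of_involutive hf hg,
      Subgroup.zpowers_inv]

end Involutions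

section Meanders

variable {f g : Equiv.Perm ℤ} {E : Set ℤ} {x y : ℤ}

lemma IsMeander.apply_mem (hE : IsMeander f g E) (hy : y ∈ E) : f y ∈ E ∧ g y ∈ E := by
  obtain ⟨x, rfl⟩ := hE
  have h : ∀ k ∈ ({f, g} : Set (Equiv.Perm ℤ)), k y ∈ MulAction.orbit (Subgroup.closure {f, g}) x :=
    fun k hk => MulAction.mem_orbit_of_mem_orbit
      (⟨k, Subgroup.subset_closure hk⟩ : Subgroup.closure {f, g}) hy
  exact ⟨h f (by simp), h g (by simp)⟩

lemma IsMeander.eq_orbit (hE : IsMeander f g E) (hy : y ∈ E) :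
    E = MulAction.orbit (Subgroup.closure {f, g}) y := by
  obtain ⟨x, rfl⟩ := hE
  exact (MulAction.orbit_eq_iff.2 hy).symm

lemma IsMeander.subset (hE : IsMeander f g E) (hf : Function.Involutive f)
    (hg : Function.Involutive g) {A : Set ℤ} (hfA : ∀ y ∈ A, f y ∈ A) (hgA : ∀ y ∈ A, g y ∈ A)
    (hxE : x ∈ E) (hxA : x ∈ A) : E ⊆ A := by
  rw [hE.eq_orbit hxE]
  exact orbit_closure_pair_subset hf hg hfA hgA hxA

lemma IsEdge.isMeander (hE : IsEdge f g E) : IsMeander f g E := hE.imp fun _ h => h.1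

lemma IsMeander.isEdge_of_fixed (hE : IsMeander f g E) (hf : Function.Involutive f)
    (hg : Function.Involutive g) (hyE : y ∈ E) (hy : f y = y ∨ g y = y) : IsEdge f g E :=
  ⟨y, hE.eq_orbit hyE, (hE.eq_orbit hyE).trans (orbit_closure_pair_eq_of_fixed hf hg hy)⟩

lemma IsEdge.exists_fixed (hE : IsEdge f g E) (hf : Function.Involutive f)
    (hg : Function.Involutive g) : ∃ y ∈ E, f y = y ∨ g y = y := by
  obtain ⟨x, h, hρ⟩ := id hE
  have hfx : f x ∈ E := (hE.isMeander.apply_mem (h ▸ MulAction.mem_orbit_self x)).1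
  rw [hρ] at hfx
  obtain ⟨k, hk⟩ := mem_orbit_zpowers.1 hfx
  have hfρ (i : ℤ) : f (((f * g) ^ i) x) = ((f * g) ^ (-i + k)) x := by
    rw [left_apply_zpow hf hg, ← hk, zpow_add, Equiv.Perm.mul_apply]
  obtain ⟨m, hm⟩ := Int.even_or_odd' k
  refine ⟨((f * g) ^ m) x, hρ ▸ mem_orbit_zpowers.2 ⟨m, rfl⟩, hm.imp (fun hm => ?_) fun hm => ?_⟩
  · rw [hfρ, hm]
    congr 2; ring
  · rw [right_apply_zpow_eq_left hf, hfρ, hm]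
    congr 2; ring

end Meanders

/-! ### Modified involutions -/

section Layer

/-- A modified involution on one side of the line, together with the data it is built from. -/
structure IsLayer (n : ℕ) (Q : Set ℤ) (M : Set (ℤ × ℤ)) (τ : Equiv.Perm ℤ) : Prop where
  subset : Q ⊆ Set.Icc (1 : ℤ) (n - 1)
  isHalfArc : ∀ i j, (i, j) ∈ M → IsHalfArc n Q i j
  isModified : IsModifiedInvolution n Q M τ

lemma subLeft_involutive (c : ℤ) : Function.Involutive (Equiv.subLeft c) := fun x => by simp

lemma mem_rightHalf {l r u v x : ℤ} : x ∈ rightHalf l r u v ↔ l + r - x ∈ leftHalf l r u v :=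
  ⟨by rintro ⟨y, hy, rfl⟩; simpa using hy, fun h => ⟨_, h, by simp⟩⟩

lemma mem_extendedComponent {l r u v x : ℤ} :
    x ∈ extendedComponent l r u v ↔ x ∈ leftHalf l r u v ∨ l + r - x ∈ leftHalf l r u v := by
  rw [extendedComponent, Set.mem_union, mem_rightHalf]

namespace IsLayer

variable {n : ℕ} {Q : Set ℤ} {M : Set (ℤ × ℤ)} {τ : Equiv.Perm ℤ} {l r u v x i : ℤ}

lemma involutive (L : IsLayer n Q M τ) : Function.Involutive τ := L.isModified.involutive

lemma bounds_of_marked (L : IsLayer n Q M τ) (hc : IsComponent n Q l r) (hi : IsMarkedArc M l r i) :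
    l ≤ i ∧ 2 * i ≤ l + r - 1 := by
  obtain ⟨l', r', hc', hli, hij, hsum⟩ := L.isHalfArc _ _ hi
  obtain ⟨rfl, rfl⟩ := hc.eq_of_add_eq hc' (by lia)
  exact ⟨hli, by lia⟩

lemma mem_leftHalf_iff (L : IsLayer n Q M τ) (hc : IsComponent n Q l r)
    (huv : IsMarkedRun M l r u v) :
    x ∈ leftHalf l r u v ↔ u ≤ x ∧ x ≤ v + 1 ∧ 2 * x ≤ l + r := by
  have := L.bounds_of_marked hc (huv.2.2.1 v huv.2.1 le_rfl)
  rw [leftHalf, Set.mem_Icc]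
  split_ifs <;> lia

lemma mem_extendedComponent_iff (L : IsLayer n Q M τ) (hc : IsComponent n Q l r)
    (huv : IsMarkedRun M l r u v) : x ∈ extendedComponent l r u v ↔
      (u ≤ x ∧ x ≤ v + 1 ∧ 2 * x ≤ l + r) ∨
        (l + r ≤ 2 * x ∧ l + r - v - 1 ≤ x ∧ x ≤ l + r - u) := by
  rw [mem_extendedComponent, L.mem_leftHalf_iff hc huv, L.mem_leftHalf_iff hc huv]
  lia

lemma isMeander_extendedComponent (L : IsLayer n Q M τ) (hc : IsComponent n Q l r)
    (huv : IsMarkedRun M l r u v) :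
    IsMeander (Equiv.subLeft (l + r)) τ (extendedComponent l r u v) := by
  have hτ := L.isModified.antiToeplitz l r u v hc huv
  by_cases hv : IsCentralRun l r v
  exacts [(hτ.edge hv).isMeander, (hτ.loop hv).1]

lemma apply_mem_extendedComponent (L : IsLayer n Q M τ) (hc : IsComponent n Q l r)
    (huv : IsMarkedRun M l r u v) (hx : x ∈ extendedComponent l r u v) :
    τ x ∈ extendedComponent l r u v :=
  ((L.isMeander_extendedComponent hc huv).apply_mem hx).2

lemma eq_or_exists_isMarkedRun (L : IsLayer n Q M τ) (hc : IsComponent n Q l r)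
    (hx : x ∈ Set.Icc l r) :
    τ x = l + r - x ∨ ∃ u v, IsMarkedRun M l r u v ∧ x ∈ extendedComponent l r u v := by
  by_contra! h
  exact h.1 (L.isModified.unmodified l r hc x hx h.2)

lemma apply_mem_of_not_marked (L : IsLayer n Q M τ) (hc : IsComponent n Q l r) (hi : l - 1 ≤ i)
    (hm : ¬ IsMarkedArc M l r i) (hx : x ∈ Set.Ioo i (l + r - i)) :
    τ x ∈ Set.Ioo i (l + r - i) := by
  obtain ⟨hix, hxi⟩ := hx
  rcases L.eq_or_exists_isMarkedRun hc (x := x) ⟨by lia, by lia⟩ with h | ⟨u, v, huv, hxX⟩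
  · rw [h]
    constructor <;> lia
  · have hX := L.apply_mem_extendedComponent hc huv hxX
    have hiu : i < u ∨ v < i := by
      by_contra! h
      exact hm (huv.2.2.1 i h.1 h.2)
    have hu := huv.1
    have huv' := huv.2.1
    rw [L.mem_extendedComponent_iff hc huv] at hxX hX
    constructor <;> lia

lemma apply_mem (L : IsLayer n Q M τ) (hc : IsComponent n Q l r) (hx : x ∈ Set.Icc l r) :
    τ x ∈ Set.Icc l r := by
  have hm : ¬ IsMarkedArc M l r (l - 1) := fun h => by
    have := L.bounds_of_marked hc h
    lia
  obtain ⟨h₁, h₂⟩ := L.apply_mem_of_not_marked hc le_rfl hm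
    (x := x) ⟨by have := hx.1; lia, by have := hx.2; lia⟩
  constructor <;> lia

lemma crosses_centre (L : IsLayer n Q M τ) (hc : IsComponent n Q l r) (hx : x ∈ Set.Icc l r)
    (hne : τ x ≠ x) : 2 * min x (τ x) ≤ l + r ∧ l + r ≤ 2 * max x (τ x) := by
  rcases L.eq_or_exists_isMarkedRun hc hx with h | ⟨u, v, huv, hxX⟩
  · lia
  · rcases (L.isModified.antiToeplitz l r u v hc huv).opposite x hxX hne with ⟨h, h'⟩ | ⟨h, h'⟩ <;>
    · rw [mem_rightHalf] at h'
      rw [L.mem_leftHalf_iff hc huv] at h h'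
      lia

lemma marked_of_centre_moved (L : IsLayer n Q M τ) (hc : IsComponent n Q l r) (hx : 2 * x = l + r)
    (hne : τ x ≠ x) : IsMarkedArc M l r (x - 1) := by
  have hlr := hc.2.1
  rcases L.eq_or_exists_isMarkedRun hc (x := x) ⟨by lia, by lia⟩ with h | ⟨u, v, huv, hxX⟩
  · lia
  · have hv := huv.2.2.1 v huv.2.1 le_rfl
    have hb := L.bounds_of_marked hc hv
    rw [L.mem_extendedComponent_iff hc huv] at hxX
    convert hv using 1
    lia

/-- The half-integer arc with an end at `k + 1/2` is the one whose left end is the minimum below. -/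
lemma marked_of_fixed (L : IsLayer n Q M τ) (hc : IsComponent n Q l r) (hx : x ∈ Set.Icc l r)
    (hfix : τ x = x) {k : ℤ} (hk : min x (l + r - x) ≤ k) (hk' : k < max x (l + r - x)) :
    IsMarkedArc M l r (min k (l + r - 1 - k)) := by
  rcases L.eq_or_exists_isMarkedRun hc hx with h | ⟨u, v, huv, hxX⟩
  · lia
  · have hcentral : IsCentralRun l r v := by
      by_contra hv
      have hloop := (L.isModified.antiToeplitz l r u v hc huv).loop hv
      exact hloop.2
        (hloop.1.isEdge_of_fixed (subLeft_involutive _) L.involutive hxX (.inr hfix))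
    rw [IsCentralRun] at hcentral
    rw [L.mem_extendedComponent_iff hc huv] at hxX
    exact huv.2.2.1 _ (by lia) (by lia)

lemma exists_isMarkedRun (L : IsLayer n Q M τ) (hc : IsComponent n Q l r)
    (hi : IsMarkedArc M l r i) : ∃ u v, IsMarkedRun M l r u v ∧ u ≤ i ∧ i ≤ v := by
  have hlr := hc.2.1
  have hb (k : ℤ) (hk : IsMarkedArc M l r k) := L.bounds_of_marked hc hk
  obtain ⟨u, ⟨hu, hu'⟩, hu_max⟩ := Int.exists_greatest_of_bdd
    (P := fun k => k ≤ i ∧ ¬ IsMarkedArc M l r k) ⟨i, fun z hz => hz.1⟩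
    ⟨l - 1, by have := hb i hi; lia, fun h => by have := hb _ h; lia⟩
  obtain ⟨v, ⟨hv, hv'⟩, hv_min⟩ := Int.exists_least_of_bdd
    (P := fun k => i ≤ k ∧ ¬ IsMarkedArc M l r k) ⟨i, fun z hz => hz.1⟩
    ⟨r + 1, by have := hb i hi; lia, fun h => by have := hb _ h; lia⟩
  have hui : u ≠ i := fun e => hu' (e ▸ hi)
  have hvi : v ≠ i := fun e => hv' (e ▸ hi)
  have hall : ∀ k, u + 1 ≤ k → k ≤ v - 1 → IsMarkedArc M l r k := by
    intro k huk hkv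
    by_contra hk
    rcases le_total k i with h | h
    · have := hu_max k ⟨h, hk⟩; lia
    · have := hv_min k ⟨h, hk⟩; lia
  refine ⟨u + 1, v - 1, ⟨?_, by lia, hall, by simpa using hu', by simpa using hv'⟩, by lia, by lia⟩
  exact (hb _ (hall (u + 1) le_rfl (by lia))).1

lemma exists_fixed_of_marked_trivial (L : IsLayer n Q M τ) {k : ℤ} (hk : (k, k) ∈ M) :
    ∃ l r x, IsComponent n Q l r ∧ 2 * k + 1 = l + r ∧ x ∈ Set.Icc l r ∧ τ x = x := by
  obtain ⟨l, r, hc, hlk, -, hsum⟩ := L.isHalfArc _ _ hk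
  have hm : IsMarkedArc M l r k := by
    rw [IsMarkedArc]; convert hk using 2; lia
  obtain ⟨u, v, huv, -, hv⟩ := L.exists_isMarkedRun hc hm
  have hvb := L.bounds_of_marked hc (huv.2.2.1 v huv.2.1 le_rfl)
  have hcentral : IsCentralRun l r v := by rw [IsCentralRun]; lia
  obtain ⟨x, hx, hfix⟩ := ((L.isModified.antiToeplitz l r u v hc huv).edge hcentral).exists_fixed
    (subLeft_involutive _) L.involutive
  rw [L.mem_extendedComponent_iff hc huv] at hx
  have hlu := huv.1
  refine ⟨l, r, x, hc, by lia, ⟨by lia, by lia⟩, hfix.resolve_left fun h => ?_⟩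
  rw [Equiv.subLeft_apply] at h
  lia

end IsLayer

end Layer

/-! ### Centres of components -/

section Centres

variable {n : ℕ} {P : Side → Set ℤ} {M : Side → Set (ℤ × ℤ)} {σ : Side → Equiv.Perm ℤ}
  {s s' : Side} {l r l' r' k k' x : ℤ}

lemma IsHalfArc.mem_Icc {Q : Set ℤ} {i j : ℤ} (h : IsHalfArc n Q i j) :
    i ∈ Set.Icc (1 : ℤ) (n - 1) ∧ j ∈ Set.Icc (1 : ℤ) (n - 1) := by
  obtain ⟨l, r, hc, hli, hij, hsum⟩ := h
  have := hc.1
  have := hc.2.2.1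
  exact ⟨⟨by lia, by lia⟩, ⟨by lia, by lia⟩⟩

lemma IsComponent.isHalfArc {Q : Set ℤ} (hc : IsComponent n Q l r) (hk : k ∈ Set.Ico l r) :
    IsHalfArc n Q (min k (l + r - 1 - k)) (max k (l + r - 1 - k)) :=
  ⟨l, r, hc, by have := hk.1; have := hk.2; lia, by lia, by lia⟩

lemma IsHalfArc.sameHalfMeander {i j : ℤ} (h : IsHalfArc n (P s) i j) : SameHalfMeander n P i j :=
  .rel _ _ ⟨s, h⟩

lemma SameHalfMeander.symm (h : SameHalfMeander n P k k') : SameHalfMeander n P k' k :=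
  Relation.EqvGen.symm _ _ h

lemma SameHalfMeander.trans {k'' : ℤ} (h : SameHalfMeander n P k k')
    (h' : SameHalfMeander n P k' k'') : SameHalfMeander n P k k'' :=
  Relation.EqvGen.trans _ _ _ h h'

lemma IsComponent.sameHalfMeander (hc : IsComponent n (P s) l r) (hk : k ∈ Set.Ico l r) :
    SameHalfMeander n P k (l + r - 1 - k) := by
  have h := (hc.isHalfArc hk).sameHalfMeander
  rcases le_total k (l + r - 1 - k) with hle | hle
  · rwa [min_eq_left hle, max_eq_right hle] at h
  · rw [min_eq_right hle, max_eq_left hle] at h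
    exact h.symm

lemma IsComponent.sameHalfMeander_min (hc : IsComponent n (P s) l r) (hk : k ∈ Set.Ico l r) :
    SameHalfMeander n P k (min k (l + r - 1 - k)) := by
  rcases min_choice k (l + r - 1 - k) with h | h <;> rw [h]
  exacts [.refl _, hc.sameHalfMeander hk]

lemma IsMarking.unique (hM : IsMarking n P M) {i j i' j' : ℤ} (h : (i, j) ∈ M s)
    (h' : (i', j') ∈ M s') (hs : SameHalfMeander n P i i') : s = s' ∧ i = i' ∧ j = j' := by
  obtain ⟨q, -, hq⟩ := hM.existsUnique i (hM.isHalfArc s i j h).mem_Icc.1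
  simpa using (hq (s, i, j) ⟨h, .refl _⟩).trans (hq (s', i', j') ⟨h', hs⟩).symm

lemma IsMarking.eq_of_marked (hM : IsMarking n P M) (hc : IsComponent n (P s) l r)
    (hc' : IsComponent n (P s') l' r') (hk : k ∈ Set.Ico l r) (hk' : k' ∈ Set.Ico l' r')
    (hm : IsMarkedArc (M s) l r (min k (l + r - 1 - k)))
    (hm' : IsMarkedArc (M s') l' r' (min k' (l' + r' - 1 - k')))
    (hkk' : SameHalfMeander n P k k') : s = s' ∧ (k' = k ∨ k' = l + r - 1 - k) := by
  obtain ⟨hs, hmin, hsum⟩ := hM.unique hm hm'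
    ((hc.sameHalfMeander_min hk).symm.trans (hkk'.trans (hc'.sameHalfMeander_min hk')))
  exact ⟨hs, by lia⟩

/-- All the half-integer arcs around the centre of `[l, r]` inside `x` and `κ(x)` are marked, so no
arc on the other side may join two of them or be trivial at an end of one of them. -/
lemma centre_not_between (hM : IsMarking n P M) (L : ∀ s, IsLayer n (P s) (M s) (σ s))
    (hss : s ≠ s') (hc : IsComponent n (P s) l r) (hc' : IsComponent n (P s') l' r')
    (hx : x ∈ Set.Icc l r) (hx' : x ∈ Set.Icc l' r') (hfix : σ s x = x) (hne : σ s' x ≠ x) :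
    ¬ ((2 * x ≤ l' + r' ∧ l' + r' < l + r) ∨ (l + r < l' + r' ∧ l' + r' ≤ 2 * x)) := by
  intro hbetween
  obtain ⟨hlx, hxr⟩ := id hx
  obtain ⟨hlx', hxr'⟩ := id hx'
  have hm (k : ℤ) := (L s).marked_of_fixed hc hx hfix (k := k)
  obtain ⟨k, hk | hk⟩ := Int.even_or_odd' (l' + r')
  · rcases eq_or_ne k x with rfl | hkx
    · have hm' := (L s').marked_of_centre_moved hc' hk.symm hne
      obtain ⟨j, hj, hj', hjk⟩ :
          ∃ j, min k (l + r - k) ≤ j ∧ j < max k (l + r - k) ∧ (j = k - 1 ∨ j = k) := by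
        rcases hbetween with h | h
        exacts [⟨k, by lia, by lia, .inr rfl⟩, ⟨k - 1, by lia, by lia, .inl rfl⟩]
      have hb := (L s').bounds_of_marked hc' hm'
      have hmin : min j (l' + r' - 1 - j) = k - 1 := by lia
      exact hss (hM.eq_of_marked hc hc' (k := j) ⟨by lia, by lia⟩ ⟨by lia, by lia⟩
        (hm j hj hj') (by rwa [hmin]) (.refl _)).1
    · have hjoin := hc'.sameHalfMeander (k := k - 1) ⟨by lia, by lia⟩
      rw [show l' + r' - 1 - (k - 1) = k by lia] at hjoin
      have := (hM.eq_of_marked hc hc ⟨by lia, by lia⟩ ⟨by lia, by lia⟩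
        (hm (k - 1) (by lia) (by lia)) (hm k (by lia) (by lia)) hjoin).2
      lia
  · have htrivial : IsHalfArc n (P s') k k := ⟨l', r', hc', by lia, le_rfl, by lia⟩
    have := hM.trivial_of_edge s _ _ (hm k (by lia) (by lia))
      ⟨s', k, htrivial, (hc.sameHalfMeander_min ⟨by lia, by lia⟩).symm⟩
    lia

lemma centre_le_of_le_of_le (hM : IsMarking n P M) (L : ∀ s, IsLayer n (P s) (M s) (σ s))
    (hss : s ≠ s') (hc : IsComponent n (P s) l r) (hc' : IsComponent n (P s') l' r')
    (hx : x ∈ Set.Icc l r) (hx' : x ∈ Set.Icc l' r') (hle : σ s x ≤ x) (hle' : x ≤ σ s' x)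
    (hne : σ s x ≠ σ s' x) :
    l + r ≤ l' + r' ∧ (l + r = l' + r' → ∃ t, σ t x = x) := by
  have hcross := (L s).crosses_centre hc hx
  have hcross' := (L s').crosses_centre hc' hx'
  by_cases hfix : σ s x = x
  · have := centre_not_between hM L hss hc hc' hx hx' hfix (by lia)
    exact ⟨by lia, fun _ => ⟨s, hfix⟩⟩
  by_cases hfix' : σ s' x = x
  · have := centre_not_between hM L hss.symm hc' hc hx' hx hfix' hfix
    exact ⟨by lia, fun _ => ⟨s', hfix'⟩⟩
  refine ⟨by lia, fun heq => absurd ?_ hss⟩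
  have hm := (L s).marked_of_centre_moved hc (x := x) (by lia) hfix
  have hm' := (L s').marked_of_centre_moved hc' (x := x) (by lia) hfix'
  exact (hM.unique hm hm' (.refl _)).1

end Centres

/-! ### Concentric components -/

section HalfKappa

variable {n : ℕ} {Q : Set ℤ} {l r k x : ℤ}

open Classical in
/-- The involution of the half-integer points induced by `κ`: it exchanges `k + 1/2` and
`l + r - 1 - k + 1/2` if these are inside the component `[l, r]`, and it fixes the half-integer
points that are not inside a component. -/
noncomputable def halfKappa (n : ℕ) (Q : Set ℤ) (k : ℤ) : ℤ :=
  if h : ∃ l r, IsComponent n Q l r ∧ k ∈ Set.Ico l r then h.choose + h.choose_spec.choose - 1 - k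
  else k

lemma IsComponent.halfKappa_eq (hc : IsComponent n Q l r) (hk : k ∈ Set.Ico l r) :
    halfKappa n Q k = l + r - 1 - k := by
  have h : ∃ l r, IsComponent n Q l r ∧ k ∈ Set.Ico l r := ⟨l, r, hc, hk⟩
  obtain ⟨hc', hk'⟩ := h.choose_spec.choose_spec
  obtain ⟨hl, hr⟩ := hc.eq_of_mem hc' (Set.Ico_subset_Icc_self hk) (Set.Ico_subset_Icc_self hk')
  rw [halfKappa, dif_pos h]
  lia

lemma halfKappa_involutive : Function.Involutive (halfKappa n Q) := by
  intro k
  by_cases h : ∃ l r, IsComponent n Q l r ∧ k ∈ Set.Ico l r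
  · obtain ⟨l, r, hc, hk⟩ := h
    have := hk.1
    have := hk.2
    rw [hc.halfKappa_eq hk, hc.halfKappa_eq ⟨by lia, by lia⟩]
    lia
  · have hk : halfKappa n Q k = k := dif_neg h
    rw [hk, hk]

lemma exists_isComponent_of_mem (hQ : Q ⊆ Set.Icc (1 : ℤ) (n - 1)) (hk : k ∈ Q) :
    ∃ l r, IsComponent n Q l r ∧ k ∈ Set.Ico l r := by
  have hk' := hQ hk
  obtain ⟨l, r, hc, hlk, hkr⟩ := exists_isComponent hQ (x := k) ⟨hk'.1, by have := hk'.2; lia⟩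
  exact ⟨l, r, hc, hlk, lt_of_le_of_ne hkr fun h => hc.2.2.2.2.2 (h ▸ hk)⟩

lemma IsComponent.disjoint_of_ne {l' r' : ℤ} (hc : IsComponent n Q l r)
    (hc' : IsComponent n Q l' r') (hne : l ≠ l') : r < l' ∨ r' < l := by
  by_contra! h
  exact hne (hc.eq_of_mem hc' (x := max l l') ⟨by lia, by have := hc.2.1; lia⟩
    ⟨by lia, by have := hc'.2.1; lia⟩).1

lemma ncard_eq_zero_of_halfKappa_ne {A : Set ℤ} (hA : A.Finite)
    (hstable : ∀ k ∈ A, halfKappa n Q k ∈ A) (hne : ∀ k ∈ A, halfKappa n Q k ≠ k) :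
    (A.ncard : ZMod 2) = 0 := by
  have hempty : {k ∈ A | halfKappa n Q k = k} = ∅ :=
    Set.eq_empty_of_forall_notMem fun k hk => hne k hk.1 hk.2
  rw [ncard_eq_ncard_fixed halfKappa_involutive hA hstable, hempty, Set.ncard_empty, Nat.cast_zero]

lemma IsMarking.halfKappa_ne_self {P : Side → Set ℤ} {M : Side → Set (ℤ × ℤ)} {s t : Side} {q : ℤ}
    (hM : IsMarking n P M) (hc : IsComponent n (P s) l r) (hq : q ∈ Set.Ico l r)
    (hm : IsMarkedArc (M s) l r (min q (l + r - 1 - q))) (hne : halfKappa n (P s) q ≠ q)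
    (hqk : SameHalfMeander n P q k) (hk : ∃ l r, IsComponent n (P t) l r ∧ k ∈ Set.Ico l r) :
    halfKappa n (P t) k ≠ k := by
  obtain ⟨l', r', hc', hk'⟩ := hk
  rw [hc'.halfKappa_eq hk']
  rw [hc.halfKappa_eq hq] at hne
  intro hfix
  have := hM.trivial_of_edge s _ _ hm
    ⟨t, k, ⟨l', r', hc', hk'.1, le_rfl, by lia⟩, (hc.sameHalfMeander_min hq).symm.trans hqk⟩
  lia

lemma Side.flip_ne (s : Side) : s.flip ≠ s := by cases s <;> simp [Side.flip]

end HalfKappa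

/-- A set `E` of points that is stable under both modified involutions, together with a component
on each side such that these two are concentric, with centre `c / 2`, and contain all the fixed
points in `E` of the involution on their side. -/
structure IsConcentric (n : ℕ) (P : Side → Set ℤ) (M : Side → Set (ℤ × ℤ))
    (σ : Side → Equiv.Perm ℤ) (E : Set ℤ) (cl cr : Side → ℤ) (c : ℤ) : Prop where
  layer : ∀ s, IsLayer n (P s) (M s) (σ s)
  marking : IsMarking n P M
  subset : E ⊆ Set.Icc (1 : ℤ) n
  stable : ∀ s, ∀ x ∈ E, σ s x ∈ E
  component : ∀ s, IsComponent n (P s) (cl s) (cr s)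
  centre : ∀ s, cl s + cr s = c
  fixed : ∀ s, ∀ x ∈ E, σ s x = x → x ∈ Set.Icc (cl s) (cr s)

open Classical in
/-- The height of the half-integer point `k + 1/2`: the parity of the number of points of `E` to
its left, corrected to the right of the centre by the parity of `E`, so that a fixed point on one
side does not prevent it from being constant along half-integer arcs. -/
noncomputable def height (E : Set ℤ) (c k : ℤ) : ZMod 2 :=
  (E ∩ Set.Icc 1 k).ncard + if c ≤ 2 * k then (E.ncard : ZMod 2) else 0

lemma ncard_inter_Icc {E : Set ℤ} {i j : ℤ} (hi : 0 ≤ i) (hij : i ≤ j) :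
    (E ∩ Set.Icc 1 j).ncard = (E ∩ Set.Icc 1 i).ncard + (E ∩ Set.Ioc i j).ncard := by
  have hunion : Set.Icc 1 j = Set.Icc 1 i ∪ Set.Ioc i j := by
    ext x
    simp only [Set.mem_union, Set.mem_Icc, Set.mem_Ioc]
    lia
  rw [hunion, Set.inter_union_distrib_left]
  exact Set.ncard_union_eq (Set.disjoint_left.2 fun x hx hx' => hx.2.2.not_gt hx'.2.1)
    ((Set.finite_Icc _ _).inter_of_right _) ((Set.finite_Ioc _ _).inter_of_right _)

namespace IsConcentric

variable {n : ℕ} {P : Side → Set ℤ} {M : Side → Set (ℤ × ℤ)} {σ : Side → Equiv.Perm ℤ}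
  {E Y : Set ℤ} {cl cr : Side → ℤ} {c l r k x : ℤ} {s : Side}
  (C : IsConcentric n P M σ E cl cr c)

include C

lemma finite : E.Finite := (Set.finite_Icc _ _).subset C.subset

lemma ncard_inter_eq_ncard_fixed (hY : ∀ x ∈ Y, σ s x ∈ Y) :
    ((E ∩ Y).ncard : ZMod 2) = {x ∈ E ∩ Y | σ s x = x}.ncard :=
  ncard_eq_ncard_fixed (C.layer s).involutive (C.finite.inter_of_left Y)
    fun x hx => ⟨C.stable s x hx.1, hY x hx.2⟩

lemma ncard_inter_eq_zero (hY : ∀ x ∈ Y, σ s x ∈ Y) (h : ∀ x ∈ Y, x ∉ Set.Icc (cl s) (cr s)) :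
    ((E ∩ Y).ncard : ZMod 2) = 0 := by
  have hempty : {x ∈ E ∩ Y | σ s x = x} = ∅ :=
    Set.eq_empty_of_forall_notMem fun x hx => h x hx.1.2 (C.fixed s x hx.1.1 hx.2)
  rw [C.ncard_inter_eq_ncard_fixed hY, hempty, Set.ncard_empty, Nat.cast_zero]

lemma ncard_inter_eq (hY : ∀ x ∈ Y, σ s x ∈ Y) (h : ∀ x ∈ E, σ s x = x → x ∈ Y) :
    ((E ∩ Y).ncard : ZMod 2) = E.ncard := by
  rw [C.ncard_inter_eq_ncard_fixed hY,
    ncard_eq_ncard_fixed (C.layer s).involutive C.finite (C.stable s)]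
  congr 2
  ext x
  exact ⟨fun hx => ⟨hx.1.1, hx.2⟩, fun hx => ⟨⟨hx.1, h x hx.1 hx.2⟩, hx.2⟩⟩

lemma height_eq_zero (hk : k ∉ P s) : height E c k = 0 := by
  have hE : E ∩ Set.Icc 1 k = E ∩ (Set.Icc 1 k ∩ Set.Icc (1 : ℤ) n) := by
    rw [Set.inter_comm (Set.Icc 1 k), ← Set.inter_assoc, Set.inter_eq_left.2 C.subset]
  have hY : ∀ x ∈ Set.Icc 1 k ∩ Set.Icc (1 : ℤ) n, σ s x ∈ Set.Icc 1 k ∩ Set.Icc (1 : ℤ) n := by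
    rintro x ⟨⟨-, hxk⟩, hx⟩
    obtain ⟨l, r, hc, hlr⟩ := exists_isComponent (C.layer s).subset hx
    have hr : r ≤ k := by
      by_contra! h
      exact hk (hc.linked k (hlr.1.trans hxk) h)
    have := (C.layer s).apply_mem hc hlr
    have := hc.1
    have := hc.2.2.1
    simp only [Set.mem_inter_iff, Set.mem_Icc] at *
    lia
  have hcomp := C.component s
  have hcentre := C.centre s
  have hle := hcomp.2.1
  rw [height, hE]
  rcases lt_or_ge k (cl s) with h | h
  · rw [C.ncard_inter_eq_zero hY fun x hx hx' => by have := hx.1.2; have := hx'.1; lia,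
      if_neg (by lia), add_zero]
  · have hr : cr s ≤ k := by
      by_contra! h'
      exact hk (hcomp.linked k h h')
    rw [C.ncard_inter_eq hY fun x hx hfix =>
        ⟨⟨(C.subset hx).1, (C.fixed s x hx hfix).2.trans hr⟩, C.subset hx⟩,
      if_pos (by lia), CharTwo.add_self_eq_zero]

lemma height_eq_of_not_marked {i : ℤ} (hc : IsComponent n (P s) l r) (hi : l ≤ i)
    (hi' : 2 * i < l + r - 1) (hm : ¬ IsMarkedArc (M s) l r i) :
    height E c (l + r - 1 - i) = height E c i := by
  have hinner : ∀ x ∈ Set.Ioc i (l + r - 1 - i), σ s x ∈ Set.Ioc i (l + r - 1 - i) := by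
    intro x hx
    have := (C.layer s).apply_mem_of_not_marked hc (by lia) hm (x := x)
    simp only [Set.mem_Ioc, Set.mem_Ioo] at *
    lia
  have hcomp := C.component s
  have hcentre := C.centre s
  have hle := hcomp.2.1
  have hl := hc.1
  rw [height, height, ncard_inter_Icc (by lia) (show i ≤ l + r - 1 - i by lia), Nat.cast_add]
  rcases eq_or_ne l (cl s) with hlcl | hlcl
  · obtain ⟨-, hr⟩ := hc.eq_of_mem hcomp ⟨le_rfl, hc.2.1⟩ ⟨hlcl.ge, hlcl.trans_le hle⟩
    have hfixed : ∀ x ∈ E, σ s x = x → x ∈ Set.Ioc i (l + r - 1 - i) := by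
      intro x hx hfix
      by_contra hxY
      rw [Set.mem_Ioc] at hxY
      have hx' : x ∈ Set.Icc l r := hlcl ▸ hr ▸ C.fixed s x hx hfix
      have := (C.layer s).marked_of_fixed hc hx' hfix (k := i) (by lia) (by lia)
      exact hm (by rwa [min_eq_left (by lia)] at this)
    rw [C.ncard_inter_eq hinner hfixed, if_pos (by lia), if_neg (by lia), add_assoc,
      CharTwo.add_self_eq_zero]
  · have hout := hc.disjoint_of_ne hcomp hlcl
    rw [C.ncard_inter_eq_zero hinner fun x hx hx' => by
      have := hx.1; have := hx.2; have := hx'.1; have := hx'.2; lia, add_zero]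
    congr 2
    exact propext (by lia)

lemma height_halfKappa_of_not_marked (hc : IsComponent n (P s) l r) (hk : k ∈ Set.Ico l r)
    (hm : ¬ IsMarkedArc (M s) l r (min k (l + r - 1 - k))) :
    height E c (halfKappa n (P s) k) = height E c k := by
  have := hk.1
  have := hk.2
  rw [hc.halfKappa_eq hk]
  rcases lt_trichotomy (2 * k) (l + r - 1) with h | h | h
  · exact C.height_eq_of_not_marked hc hk.1 h (by rwa [min_eq_left (by lia)] at hm)
  · congr 1; lia
  · rw [min_eq_right (by lia)] at hm
    have := C.height_eq_of_not_marked hc (by lia) (by lia) hm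
    rw [← this]
    congr 1; lia

lemma mem_of_height_eq_one (s : Side) (hk : height E c k = 1) : k ∈ P s := by
  by_contra h
  rw [C.height_eq_zero h] at hk
  exact zero_ne_one hk

lemma height_halfKappa_of_sameHalfMeander {t : Side} {q : ℤ} (hc : IsComponent n (P s) l r)
    (hq : q ∈ Set.Ico l r) (hm : IsMarkedArc (M s) l r (min q (l + r - 1 - q)))
    (hqk : SameHalfMeander n P q k) (hk : height E c k = 1)
    (hne : t = s → k ≠ q ∧ k ≠ halfKappa n (P s) q) :
    SameHalfMeander n P q (halfKappa n (P t) k) ∧ height E c (halfKappa n (P t) k) = 1 := by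
  obtain ⟨l', r', hc', hk'⟩ :=
    exists_isComponent_of_mem (C.layer t).subset (C.mem_of_height_eq_one t hk)
  refine ⟨hqk.trans ?_, (C.height_halfKappa_of_not_marked hc' hk' fun hm' => ?_).trans hk⟩
  · rw [hc'.halfKappa_eq hk']
    exact hc'.sameHalfMeander hk'
  · obtain ⟨hst, hk''⟩ := C.marking.eq_of_marked hc hc' hq hk' hm hm' hqk
    rw [← hc.halfKappa_eq hq] at hk''
    exact hk''.elim (hne hst.symm).1 (hne hst.symm).2

/-- The points of height `1` on a loop are paired by the arcs on the other side; if only one end of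
the marked arc had height `1`, the other points of height `1` would be paired on this side too. -/
lemma height_halfKappa_of_height_eq_one {q : ℤ} (hq : height E c q = 1) :
    height E c (halfKappa n (P s) q) = 1 := by
  by_contra hq'
  obtain ⟨l, r, hc, hqlr⟩ :=
    exists_isComponent_of_mem (C.layer s).subset (C.mem_of_height_eq_one s hq)
  have hm : IsMarkedArc (M s) l r (min q (l + r - 1 - q)) := by
    by_contra hm
    exact hq' ((C.height_halfKappa_of_not_marked hc hqlr hm).trans hq)
  have hqq : halfKappa n (P s) q ≠ q := fun h => hq' (h.symm ▸ hq)
  set Z : Set ℤ := {k | SameHalfMeander n P q k ∧ height E c k = 1}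
  have hfin : Z.Finite :=
    (Set.finite_Icc _ _).subset fun k hk => (C.layer s).subset (C.mem_of_height_eq_one s hk.2)
  have hqZ : q ∈ Z := ⟨.refl _, hq⟩
  have hne {t : Side} {k : ℤ} (hk : k ∈ Z) : halfKappa n (P t) k ≠ k :=
    C.marking.halfKappa_ne_self hc hqlr hm hqq hk.1
      (exists_isComponent_of_mem (C.layer t).subset (C.mem_of_height_eq_one t hk.2))
  have hstable {t : Side} {k : ℤ} (hk : k ∈ Z) (hkq : t = s → k ≠ q) : halfKappa n (P t) k ∈ Z :=
    C.height_halfKappa_of_sameHalfMeander hc hqlr hm hk.1 hk.2 fun hts =>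
      ⟨hkq hts, fun h => hq' (h ▸ hk.2)⟩
  have heven : (Z.ncard : ZMod 2) = 0 := ncard_eq_zero_of_halfKappa_ne hfin
    (fun k hk => hstable hk fun h => absurd h s.flip_ne) fun k hk => hne hk
  have heven' : ((Z \ {q}).ncard : ZMod 2) = 0 := by
    refine ncard_eq_zero_of_halfKappa_ne (Q := P s) hfin.sdiff (fun k hk => ?_) fun k hk => hne hk.1
    refine ⟨hstable hk.1 fun _ => hk.2, fun h => hq' ?_⟩
    rw [← (h : halfKappa n (P s) k = q), halfKappa_involutive]
    exact hk.1.2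
  rw [← Set.ncard_sdiff_singleton_add_one hqZ hfin, Nat.cast_add, heven'] at heven
  simp at heven

lemma height_halfKappa : height E c (halfKappa n (P s) k) = height E c k := by
  have hz : ∀ a b : ZMod 2, (b = 1 → a = 1) → (a = 1 → b = 1) → a = b := by decide
  refine hz _ _ C.height_halfKappa_of_height_eq_one fun h => ?_
  rw [← halfKappa_involutive (Q := P s) k]
  exact C.height_halfKappa_of_height_eq_one h

lemma height_reflect (hc : IsComponent n (P s) l r) (hk : k ∈ Set.Icc (l - 1) r) :
    height E c (l + r - 1 - k) = height E c k := by
  have hl : height E c (l - 1) = 0 := C.height_eq_zero hc.2.2.2.2.1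
  have hr : height E c r = 0 := C.height_eq_zero hc.2.2.2.2.2
  by_cases hkl : k = l - 1
  · rw [hkl, hl, show l + r - 1 - (l - 1) = r by ring, hr]
  by_cases hkr : k = r
  · rw [hkr, hr, show l + r - 1 - r = l - 1 by ring, hl]
  · have := hk.1
    have := hk.2
    rw [← hc.halfKappa_eq ⟨by lia, by lia⟩, C.height_halfKappa]

/-- If `E` has an odd number of points, both involutions have a fixed point in `E`; but only one of
them could have one if there were a half-integer point at the centre. -/
lemma even_centre (hE : (E.ncard : ZMod 2) ≠ 0) : Even c := by
  by_contra hodd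
  obtain ⟨k, rfl⟩ := Int.not_even_iff_odd.1 hodd
  have hmarked (s : Side) : (k, k) ∈ M s := by
    have hcentre := C.centre s
    obtain ⟨x, hx, hfix⟩ : {x ∈ E | σ s x = x}.Nonempty := by
      by_contra! hempty
      rw [ncard_eq_ncard_fixed (C.layer s).involutive C.finite (C.stable s), hempty] at hE
      simp at hE
    have := (C.layer s).marked_of_fixed (C.component s) (C.fixed s x hx hfix) hfix (k := k)
      (by lia) (by lia)
    rw [IsMarkedArc] at this
    convert this using 2 <;> lia
  simpa using (C.marking.unique (hmarked .above) (hmarked .below) (.refl _)).1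

open Classical in
lemma height_eq_height_pred (hx : 1 ≤ x) :
    height E c x = height E c (x - 1) +
      ((if x ∈ E then 1 else 0) + if 2 * x = c then (E.ncard : ZMod 2) else 0) := by
  have hpoint : (E ∩ Set.Ioc (x - 1) x).ncard = if x ∈ E then 1 else 0 := by
    have hIoc : Set.Ioc (x - 1) x = {x} := by
      ext y
      simp only [Set.mem_Ioc, Set.mem_singleton_iff]
      lia
    rw [hIoc]
    split_ifs with h
    · rw [Set.inter_eq_right.2 (Set.singleton_subset_iff.2 h), Set.ncard_singleton]
    · rw [Set.inter_singleton_eq_empty.2 h, Set.ncard_empty]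
  have hjump : (if c ≤ 2 * x then (E.ncard : ZMod 2) else 0) =
      (if c ≤ 2 * (x - 1) then (E.ncard : ZMod 2) else 0) +
        if 2 * x = c then (E.ncard : ZMod 2) else 0 := by
    by_cases hE : (E.ncard : ZMod 2) = 0
    · simp [hE]
    · obtain ⟨m, hm⟩ := C.even_centre hE
      split_ifs <;> first | (exfalso; lia) | rw [add_zero] | rw [zero_add]
  rw [height, height, ncard_inter_Icc (by lia) (show x - 1 ≤ x by lia), hpoint, hjump]
  push_cast
  ring

lemma mem_reflect (hc : IsComponent n (P s) l r) (hx : x ∈ Set.Icc l r) :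
    l + r - x ∈ E ↔ x ∈ E := by
  obtain ⟨hlx, hxr⟩ := hx
  have hl := hc.1
  have hjump := C.height_eq_height_pred (x := x) (by lia)
  have hjump' := C.height_eq_height_pred (x := l + r - x) (by lia)
  have h₁ := C.height_reflect hc (k := x) ⟨by lia, hxr⟩
  have h₂ := C.height_reflect hc (k := x - 1) ⟨by lia, by lia⟩
  rw [show l + r - 1 - (x - 1) = l + r - x by ring] at h₂
  have hcentre : 2 * (l + r - x) = c ↔ 2 * x = c := by
    have hcen := C.centre s
    have hle := (C.component s).2.1
    by_cases hlcl : l = cl s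
    · obtain ⟨-, rfl⟩ := hc.eq_of_mem (C.component s) ⟨le_rfl, hc.2.1⟩ ⟨hlcl.ge, hlcl.trans_le hle⟩
      lia
    · have := hc.disjoint_of_ne (C.component s) hlcl
      lia
  rw [h₂, show l + r - x - 1 = l + r - 1 - x by ring, h₁, hjump, add_assoc, left_eq_add,
    if_congr hcentre rfl rfl] at hjump'
  have hz : ∀ a b p : ZMod 2, a + p + (b + p) = 0 → a = b := by decide
  have := hz _ _ _ hjump'
  by_cases h : x ∈ E <;> by_cases h' : l + r - x ∈ E <;>
    simp only [h, h', if_true, if_false, zero_ne_one, one_ne_zero] at this ⊢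

lemma mem_succ_of_marked {i j : ℤ} (h : (i, j) ∈ M s) : i ∈ E ↔ i + 1 ∈ E := by
  obtain ⟨l, r, hc, hli, hij, hsum⟩ := (C.layer s).isHalfArc _ _ h
  have hm : IsMarkedArc (M s) l r i := by rw [IsMarkedArc]; convert h using 2; lia
  rcases eq_or_lt_of_le hij with rfl | hlt
  · rw [← C.mem_reflect hc ⟨hli, by lia⟩, show l + r - i = i + 1 by lia]
  · obtain ⟨u, v, huv, hui, hiv⟩ := (C.layer s).exists_isMarkedRun hc hm
    have hreflect : ∀ x ∈ E ∩ Set.Icc l r, Equiv.subLeft (l + r) x ∈ E ∩ Set.Icc l r :=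
      fun x hx => ⟨(C.mem_reflect hc hx.2).2 hx.1, by
        have := hx.2.1; have := hx.2.2; rw [Equiv.subLeft_apply, Set.mem_Icc]; lia⟩
    have hstable : ∀ x ∈ E ∩ Set.Icc l r, σ s x ∈ E ∩ Set.Icc l r := fun x hx =>
      ⟨C.stable s x hx.1, (C.layer s).apply_mem hc hx.2⟩
    have hsub {x : ℤ} (hxX : x ∈ extendedComponent l r u v) (hx : x ∈ E ∩ Set.Icc l r) :
        extendedComponent l r u v ⊆ E ∩ Set.Icc l r :=
      ((C.layer s).isMeander_extendedComponent hc huv).subset (subLeft_involutive _)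
        (C.layer s).involutive hreflect hstable hxX hx
    have hi : i ∈ extendedComponent l r u v := by
      rw [(C.layer s).mem_extendedComponent_iff hc huv]; lia
    have hi' : i + 1 ∈ extendedComponent l r u v := by
      rw [(C.layer s).mem_extendedComponent_iff hc huv]; lia
    exact ⟨fun h => (hsub hi ⟨h, by lia, by lia⟩ hi').1,
      fun h => (hsub hi' ⟨h, by lia, by lia⟩ hi).1⟩

lemma mem_succ_iff_of_sameHalfMeander {i j : ℤ} (h : SameHalfMeander n P i j) :
    (i ∈ E ↔ i + 1 ∈ E) ↔ (j ∈ E ↔ j + 1 ∈ E) := by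
  induction h with
  | rel i j h =>
    obtain ⟨s, l, r, hc, hli, hij, hsum⟩ := h
    rw [← C.mem_reflect hc (x := i) ⟨hli, by lia⟩, ← C.mem_reflect hc (x := i + 1) ⟨by lia, by lia⟩,
      show l + r - i = j + 1 by lia, show l + r - (i + 1) = j by lia]
    exact Iff.comm
  | refl => rfl
  | symm _ _ _ ih => exact ih.symm
  | trans _ _ _ _ _ ih ih' => exact ih.trans ih'

lemma eq_Icc (hne : E.Nonempty) : E = Set.Icc (1 : ℤ) n := by
  have hsucc : ∀ k ∈ Set.Icc (1 : ℤ) (n - 1), (k ∈ E ↔ k + 1 ∈ E) := by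
    intro k hk
    obtain ⟨⟨s, i, j⟩, ⟨hij, hki⟩, -⟩ := C.marking.existsUnique k hk
    exact (C.mem_succ_iff_of_sameHalfMeander hki).2 (C.mem_succ_of_marked hij)
  have hall : ∀ m : ℤ, 1 ≤ m → m ≤ n → (m ∈ E ↔ 1 ∈ E) := by
    intro m hm
    induction m, hm using Int.leInduction with
    | base => simp
    | succ m hm ih => exact fun hmn => (hsucc m ⟨hm, by lia⟩).symm.trans (ih (by lia))
  obtain ⟨x, hx⟩ := hne
  have h1 : (1 : ℤ) ∈ E := (hall x (C.subset hx).1 (C.subset hx).2).1 hx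
  exact Set.Subset.antisymm C.subset fun m hm => (hall m hm.1 hm.2).2 h1

/-- The half-integer point at the centre is on trivial arcs only. -/
lemma eq_of_sameHalfMeander_centre {i j : ℤ} (hi : 2 * i + 1 = c) (h : SameHalfMeander n P i j) :
    j = i := by
  suffices key : ∀ a b, SameHalfMeander n P a b → (a = i ↔ b = i) from (key i j h).1 rfl
  intro a b hab
  induction hab with
  | rel a b h =>
    obtain ⟨s, l, r, hc, hla, hab, hsum⟩ := h
    have hcentre := C.centre s
    have hle := (C.component s).2.1
    by_cases hl : l = cl s
    · obtain ⟨-, hr⟩ := hc.eq_of_mem (C.component s) ⟨le_rfl, hc.2.1⟩ ⟨hl.ge, hl.trans_le hle⟩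
      lia
    · have := hc.disjoint_of_ne (C.component s) hl
      lia
  | refl => rfl
  | symm _ _ _ ih => exact ih.symm
  | trans _ _ _ _ _ ih ih' => exact ih.trans ih'

lemma exists_central_of_trivial (hne : E.Nonempty) (hk : IsHalfArc n (P s) k k) :
    2 * k + 1 = c := by
  obtain ⟨⟨t, i, j⟩, ⟨hij, hki⟩, -⟩ := C.marking.existsUnique k hk.mem_Icc.1
  obtain rfl : i = j := C.marking.trivial_of_edge t i j hij ⟨s, k, hk, hki.symm⟩
  obtain ⟨l, r, x, hc, hi, hx, hfix⟩ := (C.layer t).exists_fixed_of_marked_trivial hij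
  have hxE : x ∈ E := by
    rw [C.eq_Icc hne]
    exact ⟨hc.1.trans hx.1, hx.2.trans hc.2.2.1⟩
  obtain ⟨rfl, rfl⟩ := hc.eq_of_mem (C.component t) hx (C.fixed t x hxE hfix)
  have hic := hi.trans (C.centre t)
  rwa [C.eq_of_sameHalfMeander_centre hic hki.symm]

/-- A component outside the central one contains no fixed points, so its number of points is even
and there is a trivial half-integer arc at its centre; but all of these are at `c / 2`. -/
lemma eq_of_isComponent (hne : E.Nonempty) (hc : IsComponent n (P s) l r) : l = cl s := by
  by_contra hl
  have hout := hc.disjoint_of_ne (C.component s) hl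
  have hcentre := C.centre s
  have hle := (C.component s).2.1
  have hlr := hc.2.1
  have hsub : E ∩ Set.Icc l r = Set.Icc l r := by
    rw [C.eq_Icc hne]
    exact Set.inter_eq_right.2 (Set.Icc_subset_Icc hc.1 hc.2.2.1)
  have heven := C.ncard_inter_eq_zero (fun x => (C.layer s).apply_mem hc) fun x hx hx' => by
    have := hx.1; have := hx.2; have := hx'.1; have := hx'.2; lia
  rw [hsub, ← Finset.coe_Icc, Set.ncard_coe_finset, Int.card_Icc,
    ZMod.natCast_eq_zero_iff_even] at heven
  obtain ⟨m, hm⟩ := heven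
  have := C.exists_central_of_trivial hne (k := l + m - 1)
    ⟨l, r, hc, by lia, le_rfl, by lia⟩
  lia

lemma inter_eq_Icc (hne : E.Nonempty) : P .above ∩ P .below = Set.Icc (1 : ℤ) (n - 1) := by
  have hmem (s : Side) {k : ℤ} (hk : k ∈ Set.Icc (1 : ℤ) (n - 1)) : k ∈ P s := by
    obtain ⟨hk1, hkn⟩ := hk
    obtain ⟨l, r, hc, hlk, -⟩ := exists_isComponent (C.layer s).subset (x := k) ⟨hk1, by lia⟩
    obtain ⟨l', r', hc', hlk', hkr'⟩ :=
      exists_isComponent (C.layer s).subset (x := k + 1) ⟨by lia, by lia⟩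
    obtain rfl := C.eq_of_isComponent hne hc
    obtain rfl := C.eq_of_isComponent hne hc'
    exact hc'.linked k hlk (by lia)
  exact Set.Subset.antisymm (fun k hk => (C.layer .above).subset hk.1)
    fun k hk => ⟨hmem .above hk, hmem .below hk⟩

end IsConcentric

/-! ### Consecutive entries of a list -/

section ListArcs

variable {α : Type*} {l l₁ l₂ l₃ : List α} {a b u v : α} {q : α × α}

/-- The set of pairs of consecutive entries of a list, that is, the arcs of the directed path
through its entries. -/
def listArcs : List α → Set (α × α)
  | a :: b :: l => insert (a, b) (listArcs (b :: l))
  | _ => ∅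

lemma mem_listArcs_iff_getElem :
    q ∈ listArcs l ↔ ∃ (i : ℕ) (h : i + 1 < l.length), q = (l[i], l[i + 1]) := by
  induction l with
  | nil => simp [listArcs]
  | cons a l ih =>
    cases l with
    | nil => simp [listArcs]
    | cons b l =>
      rw [listArcs, Set.mem_insert_iff, ih]
      constructor
      · rintro (rfl | ⟨i, h, rfl⟩)
        · exact ⟨0, by simp, rfl⟩
        · exact ⟨i + 1, by simpa using h, rfl⟩
      · rintro ⟨_ | i, h, rfl⟩
        · exact .inl rfl
        · exact .inr ⟨i, by simpa using h, rfl⟩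

lemma mem_of_mem_listArcs (h : q ∈ listArcs l) : q.1 ∈ l ∧ q.2 ∈ l := by
  obtain ⟨i, hi, rfl⟩ := mem_listArcs_iff_getElem.1 h
  exact ⟨List.getElem_mem _, List.getElem_mem _⟩

lemma exists_append_of_mem_listArcs (h : q ∈ listArcs l) :
    ∃ l₁ l₂, l = l₁ ++ l₂ ∧ q.1 ∈ l₁.getLast? ∧ q.2 ∈ l₂.head? := by
  obtain ⟨i, hi, rfl⟩ := mem_listArcs_iff_getElem.1 h
  refine ⟨l.take (i + 1), l.drop (i + 1), (List.take_append_drop _ _).symm, ?_, ?_⟩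
  · simp [List.getLast?_take, List.getElem?_eq_getElem (show i < l.length by lia)]
  · simp [List.head?_drop, List.getElem?_eq_getElem hi]

lemma listArcs_append (ha : a ∈ l₁.getLast?) (hb : b ∈ l₂.head?) :
    listArcs (l₁ ++ l₂) = listArcs l₁ ∪ insert (a, b) (listArcs l₂) := by
  obtain ⟨l₂, rfl⟩ := List.head?_eq_some_iff.1 hb
  induction l₁ with
  | nil => simp at ha
  | cons c l₁ ih =>
    cases l₁ with
    | nil =>
      obtain rfl : c = a := by simpa using ha
      simp [listArcs]
    | cons c' l₁ =>
      have ih := ih (by simpa using ha)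
      simp only [List.cons_append, listArcs] at ih ⊢
      rw [ih, Set.insert_union]

lemma listArcs_reverse (l : List α) : listArcs l.reverse = Prod.swap ⁻¹' listArcs l := by
  induction l with
  | nil => rfl
  | cons a l ih =>
    cases l with
    | nil => rfl
    | cons b l =>
      rw [List.reverse_cons, listArcs_append (a := b) (b := a) (by simp) (by simp), ih]
      ext ⟨x, y⟩
      simp only [listArcs, Set.mem_union, Set.mem_preimage, Prod.swap_prod_mk, Set.mem_insert_iff,
        Prod.mk.injEq, Set.mem_empty_iff_false]
      tauto

lemma listArcs_insert (hnodup : (l₁ ++ l₂).Nodup) (ha : a ∈ l₁.getLast?) (hb : b ∈ l₂.head?)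
    (hu : u ∈ l₃.head?) (hv : v ∈ l₃.getLast?) :
    listArcs (l₁ ++ (l₃ ++ l₂)) =
      listArcs (l₁ ++ l₂) \ {(a, b)} ∪ insert (a, u) (insert (v, b) (listArcs l₃)) := by
  have hdisj := (List.nodup_append.1 hnodup).2.2
  have h₁ : (a, b) ∉ listArcs l₁ := fun h =>
    hdisj b (mem_of_mem_listArcs h).2 b (List.mem_of_mem_head? hb) rfl
  have h₂ : (a, b) ∉ listArcs l₂ := fun h =>
    hdisj a (List.mem_of_mem_getLast? ha) a (mem_of_mem_listArcs h).1 rfl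
  have hu' : u ∈ (l₃ ++ l₂).head? := by rw [List.head?_append]; simp [Option.mem_def.1 hu]
  rw [listArcs_append ha hu', listArcs_append hv hb, listArcs_append ha hb,
    Set.union_sdiff_distrib, Set.insert_sdiff_self_of_notMem h₂, Set.sdiff_singleton_eq_self h₁]
  ext
  simp only [Set.mem_union, Set.mem_insert_iff]
  tauto

lemma listArcs_range' (s k : ℕ) :
    listArcs (List.range' s k) = (fun i => (i, i + 1)) '' Set.Ico s (s + k - 1) := by
  ext q
  simp only [mem_listArcs_iff_getElem, List.length_range', List.getElem_range', Set.mem_image,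
    Set.mem_Ico, one_mul]
  constructor
  · rintro ⟨i, hi, rfl⟩
    exact ⟨s + i, by lia, rfl⟩
  · rintro ⟨i, hi, rfl⟩
    exact ⟨i - s, by lia, by rw [Prod.mk.injEq]; lia⟩

end ListArcs

/-! ### Straightening on indices -/

section IndexStraightening

variable (e : ℕ) (d : ℕ → Prop) (sg : ℕ → ℤ)

/-- An internal turning index of an edge, in terms of the indices `1, ..., e` of its points; the
predicate `d` tells whether the arc of index `i`, which joins `i` and `i + 1`, points to `i + 1`. -/
def IsTurn (t : ℕ) : Prop := 1 < t ∧ t < e ∧ ¬ (d (t - 1) ↔ d t)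

/-- A turning index that is a source. -/
def IsSourceIndex (t : ℕ) : Prop :=
  (t = 1 ∨ t = e ∨ IsTurn e d t) ∧ (t < e → d t) ∧ (1 < t → ¬ d (t - 1))

/-- A turning index that is a sink. -/
def IsSinkIndex (t : ℕ) : Prop := IsSourceIndex e dᶜ t

/-- The directed arc of index `i`. -/
noncomputable def indexArc (i : ℕ) : ℕ × ℕ :=
  open Classical in if d i then (i, i + 1) else (i + 1, i)

/-- The arc of index `i` is deleted because of a turning index less than `m`. -/
def IsDeleted (m i : ℕ) : Prop :=
  ∃ t < m, IsTurn e d t ∧ ((sg t = 1 ∧ i + 1 = t) ∨ (sg t = -1 ∧ i = t))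

/-- The arcs of index less than `m`, except those deleted because of a turning index less than
`m`. -/
def keptArcs (m : ℕ) : Set (ℕ × ℕ) := indexArc d '' {i ∈ Set.Ico 1 m | ¬ IsDeleted e d sg m i}

/-- The indices of type `opp` after the last turning index `r < t` of type `same` and of negative
signature. -/
def laterIndices (same opp : ℕ → Prop) (t : ℕ) : Set ℕ :=
  {s | opp s ∧ ∀ r < t, IsTurn e d r → same r → sg r = -1 → r < s}

/-- The external arc assigned to the turning index `t` of type `same` crosses the index `s`. -/
def CrossesIndex (same opp : ℕ → Prop) (t s : ℕ) : Prop :=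
  (sg t = 1 ∧ IsLeast {s | opp s ∧ t < s} s) ∨
    (sg t = -1 ∧ IsLeast (laterIndices e d sg same opp t) s)

/-- The external arcs assigned to the turning index `t` (there is exactly one). -/
def externalArcsAt (t : ℕ) : Set (ℕ × ℕ) :=
  {q | ∃ s, (IsSourceIndex e d t ∧ CrossesIndex e d sg (IsSourceIndex e d) (IsSinkIndex e d) t s ∧
      q = (s, otherEnd sg t)) ∨
    (IsSinkIndex e d t ∧ CrossesIndex e d sg (IsSinkIndex e d) (IsSourceIndex e d) t s ∧
      q = (otherEnd sg t, s))}

/-- The directed arcs of the straightening of the part `1, ..., m` of the edge. -/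
def straightenedIndexArcs (m : ℕ) : Set (ℕ × ℕ) :=
  keptArcs e d sg m ∪ {q | ∃ t < m, IsTurn e d t ∧ q ∈ externalArcsAt e d sg t}

/-- The list `l` describes the straightening of the part `1, ..., m` of the edge as a directed
path. Its ends are the indices that the external arc of the turning index `m` crosses when the
signature at `m` is negative and `m` is a sink, respectively a source. -/
structure IsStraightening (m : ℕ) (l : List ℕ) : Prop where
  nodup : l.Nodup
  mem_iff : ∀ x, x ∈ l ↔ x ∈ Set.Icc 1 m
  listArcs_eq : listArcs l = straightenedIndexArcs e d sg m
  head : ∃ h ∈ l.head?, IsLeast (laterIndices e d sg (IsSinkIndex e d) (IsSourceIndex e d) m) h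
  last : ∃ k ∈ l.getLast?, IsLeast (laterIndices e d sg (IsSourceIndex e d) (IsSinkIndex e d) m) k

/-- The turning index following `t` is `m`. -/
structure IsNextTurn (t m : ℕ) : Prop where
  one_le : 1 ≤ t
  lt : t < m
  le : m ≤ e
  turn : m = e ∨ IsTurn e d m
  not_turn : ∀ x, t < x → x < m → ¬ IsTurn e d x

variable {e d sg} {t m x y : ℕ} {l : List ℕ}

section Reversal

lemma isTurn_compl : IsTurn e dᶜ t ↔ IsTurn e d t := by
  simp only [IsTurn, Pi.compl_apply, compl_iff_not, not_iff_not]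

lemma isSinkIndex_compl : IsSinkIndex e dᶜ = IsSourceIndex e d := by
  funext t; rw [IsSinkIndex, compl_compl]

lemma indexArc_compl (i : ℕ) : indexArc dᶜ i = (indexArc d i).swap := by
  by_cases h : d i <;> simp [indexArc, h]

lemma swap_preimage_keptArcs : Prod.swap ⁻¹' keptArcs e d sg m = keptArcs e dᶜ sg m := by
  have hdel : IsDeleted e dᶜ sg m = IsDeleted e d sg m := by
    ext; simp only [IsDeleted, isTurn_compl]
  simp only [keptArcs, ← Set.image_swap_eq_preimage_swap, Set.image_image, hdel, indexArc_compl]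

lemma laterIndices_compl (same opp : ℕ → Prop) :
    laterIndices e dᶜ sg same opp t = laterIndices e d sg same opp t := by
  simp only [laterIndices, isTurn_compl]

lemma swap_preimage_externalArcsAt :
    Prod.swap ⁻¹' externalArcsAt e d sg t = externalArcsAt e dᶜ sg t := by
  ext ⟨x, y⟩
  simp only [externalArcsAt, CrossesIndex, Set.mem_preimage, Set.mem_ofPred_eq, Prod.swap_prod_mk,
    Prod.mk.injEq, isSinkIndex_compl, laterIndices_compl,
    ← show IsSinkIndex e d = IsSourceIndex e dᶜ from rfl]
  exact exists_congr fun s => by tauto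

lemma swap_preimage_straightenedIndexArcs :
    Prod.swap ⁻¹' straightenedIndexArcs e d sg m = straightenedIndexArcs e dᶜ sg m := by
  rw [straightenedIndexArcs, Set.preimage_union, swap_preimage_keptArcs, straightenedIndexArcs]
  simp only [isTurn_compl, ← swap_preimage_externalArcsAt]
  rfl

lemma IsStraightening.reverse (h : IsStraightening e d sg m l) :
    IsStraightening e dᶜ sg m l.reverse where
  nodup := List.nodup_reverse.2 h.nodup
  mem_iff x := by rw [List.mem_reverse, h.mem_iff]
  listArcs_eq := by rw [listArcs_reverse, h.listArcs_eq, swap_preimage_straightenedIndexArcs]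
  head := by
    rw [List.head?_reverse, laterIndices_compl, isSinkIndex_compl]
    exact h.last
  last := by
    rw [List.getLast?_reverse, laterIndices_compl, isSinkIndex_compl]
    exact h.head

lemma IsNextTurn.compl (h : IsNextTurn e d t m) : IsNextTurn e dᶜ t m where
  one_le := h.one_le
  lt := h.lt
  le := h.le
  turn := by rw [isTurn_compl]; exact h.turn
  not_turn x := by rw [isTurn_compl]; exact h.not_turn x

end Reversal

lemma not_isDeleted_of_le (hx : t ≤ x) : ¬ IsDeleted e d sg t x := by
  rintro ⟨r, hr, -, ⟨-, h⟩ | ⟨-, h⟩⟩ <;> lia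

lemma not_isSourceIndex (he : 1 < e) (hsnk : IsSinkIndex e d t) : ¬ IsSourceIndex e d t := by
  intro hsrc
  rcases lt_or_ge t e with hte | hte
  · exact hsnk.2.1 hte (hsrc.2.1 hte)
  · exact hsnk.2.2 (he.trans_le hte) (hsrc.2.2 (he.trans_le hte))

lemma CrossesIndex.opp {same opp : ℕ → Prop} (h : CrossesIndex e d sg same opp t x) : opp x := by
  rcases h with ⟨-, h⟩ | ⟨-, h⟩ <;> exact h.1.1

namespace IsNextTurn

variable (h : IsNextTurn e d t m)
include h

lemma dir_iff (hx : x ∈ Set.Ico t m) : d x ↔ d t := by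
  obtain ⟨htx, hxm⟩ := hx
  have ht := h.one_le
  have hme := h.le
  induction x, htx using Nat.le_induction with
  | base => rfl
  | succ x htx ih =>
    refine Iff.trans ?_ (ih (by lia))
    by_contra hne
    exact h.not_turn (x + 1) (by lia) hxm ⟨by lia, by lia, fun h => hne h.symm⟩

lemma le_of_isTurn (hx : IsTurn e d x) (hxm : x < m) : x ≤ t := by
  by_contra htx
  exact h.not_turn x (by lia) hxm hx

lemma isSourceIndex (hd : ¬ d t) : IsSourceIndex e d m := by
  have hm := h.lt
  have hdm : ¬ d (m - 1) := mt (h.dir_iff ⟨by lia, by lia⟩).1 hd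
  refine ⟨.inr h.turn, fun hme => ?_, fun _ => hdm⟩
  have := h.turn.resolve_left hme.ne
  by_contra hdm'
  exact this.2.2 (iff_of_false hdm hdm')

lemma le_of_isSourceIndex (hx : IsSourceIndex e d x) (htx : t < x) : m ≤ x := by
  have ht := h.one_le
  have hme := h.le
  by_contra hxm
  rcases hx.1 with hx | hx | hx
  · lia
  · lia
  · exact h.not_turn x htx (by lia) hx

lemma isLeast_isSourceIndex (hd : ¬ d t) : IsLeast {s | IsSourceIndex e d s ∧ t < s} m :=
  ⟨⟨h.isSourceIndex hd, h.lt⟩, fun _ hs => h.le_of_isSourceIndex hs.1 hs.2⟩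

lemma laterIndices_eq {same opp : ℕ → Prop} (ht : same t → sg t ≠ -1) :
    laterIndices e d sg same opp m = laterIndices e d sg same opp t := by
  have := h.lt
  refine Set.ext fun s => and_congr_right fun _ =>
    ⟨fun hs r hr => hs r (by lia), fun hs r hr hturn hsame hsg => hs r ?_ hturn hsame hsg⟩
  refine lt_of_le_of_ne (h.le_of_isTurn hturn hr) ?_
  rintro rfl
  exact ht hsame hsg

lemma isDeleted_iff (ht : IsTurn e d t) : IsDeleted e d sg m x ↔
    IsDeleted e d sg t x ∨ (sg t = 1 ∧ x + 1 = t) ∨ (sg t = -1 ∧ x = t) := by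
  have := h.lt
  constructor
  · rintro ⟨r, hr, hturn, hx⟩
    rcases (h.le_of_isTurn hturn hr).lt_or_eq with hrt | rfl
    · exact .inl ⟨r, hrt, hturn, hx⟩
    · exact .inr hx
  · rintro (⟨r, hr, hturn, hx⟩ | hx)
    · exact ⟨r, by lia, hturn, hx⟩
    · exact ⟨t, h.lt, ht, hx⟩

lemma externalArcsAt_union (ht : IsTurn e d t) :
    {q | ∃ r < m, IsTurn e d r ∧ q ∈ externalArcsAt e d sg r} =
      {q | ∃ r < t, IsTurn e d r ∧ q ∈ externalArcsAt e d sg r} ∪ externalArcsAt e d sg t := by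
  have := h.lt
  ext q
  constructor
  · rintro ⟨r, hr, hturn, hq⟩
    rcases (h.le_of_isTurn hturn hr).lt_or_eq with hrt | rfl
    · exact .inl ⟨r, hrt, hturn, hq⟩
    · exact .inr hq
  · rintro (⟨r, hr, hturn, hq⟩ | hq)
    · exact ⟨r, by lia, hturn, hq⟩
    · exact ⟨t, h.lt, ht, hq⟩

end IsNextTurn

/-- The indices `m, m - 1, ..., t + 1`. -/
def descent (t m : ℕ) : List ℕ := (List.range' (t + 1) (m - t)).reverse

lemma mem_descent : x ∈ descent t m ↔ t < x ∧ x ≤ m := by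
  rw [descent, List.mem_reverse, List.mem_range'_1]
  lia

lemma head?_descent (h : t < m) : m ∈ (descent t m).head? := by
  rw [descent, List.head?_reverse, List.getLast?_range', if_neg (by lia), Option.mem_some_iff]
  lia

lemma getLast?_descent (h : t < m) : t + 1 ∈ (descent t m).getLast? := by
  rw [descent, List.getLast?_reverse, List.head?_range', if_neg (by lia), Option.mem_some_iff]

lemma nodup_descent_append (hl : IsStraightening e d sg t l) : (descent t m ++ l).Nodup := by
  refine List.nodup_append.2 ⟨List.nodup_reverse.2 List.nodup_range', hl.nodup, ?_⟩
  rintro x hx _ hy rfl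
  rw [mem_descent] at hx
  rw [hl.mem_iff, Set.mem_Icc] at hy
  lia

lemma mem_descent_append (hl : IsStraightening e d sg t l) (htm : t < m) (x : ℕ) :
    x ∈ descent t m ++ l ↔ x ∈ Set.Icc 1 m := by
  rw [List.mem_append, mem_descent, hl.mem_iff, Set.mem_Icc, Set.mem_Icc]
  lia

lemma listArcs_descent (h : t < m) (hd : ∀ i ∈ Set.Ioo t m, ¬ d i) :
    listArcs (descent t m) = indexArc d '' Set.Ioo t m := by
  rw [descent, listArcs_reverse, listArcs_range', ← Set.image_swap_eq_preimage_swap,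
    Set.image_image, show t + 1 + (m - t) - 1 = m by lia,
    show Set.Ico (t + 1) m = Set.Ioo t m by ext; simp]
  exact Set.image_congr fun i hi => by rw [indexArc, if_neg (hd i hi)]; rfl

section Extension

variable (h : IsNextTurn e d t m) (ht : IsTurn e d t) (hsnk : IsSinkIndex e d t)

include ht hsnk in
lemma not_dir_of_isSinkIndex : ¬ d t := hsnk.2.1 ht.2.1

include ht hsnk in
lemma dir_pred_of_isSinkIndex : d (t - 1) := not_not.1 (hsnk.2.2 ht.1)

include ht hsnk in
lemma externalArcsAt_of_isSinkIndex
    (hx : CrossesIndex e d sg (IsSinkIndex e d) (IsSourceIndex e d) t x) :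
    externalArcsAt e d sg t = {(otherEnd sg t, x)} := by
  ext q
  constructor
  · rintro ⟨s, ⟨hsrc, -⟩ | ⟨-, hs, rfl⟩⟩
    · exact absurd hsrc (not_isSourceIndex (ht.1.trans ht.2.1) hsnk)
    · rcases hs with ⟨hsg, hs⟩ | ⟨hsg, hs⟩ <;> rcases hx with ⟨hsg', hx⟩ | ⟨hsg', hx⟩
      · rw [hs.unique hx]; rfl
      · lia
      · lia
      · rw [hs.unique hx]; rfl
  · rintro rfl
    exact ⟨x, .inr ⟨hsnk, hx, rfl⟩⟩

include h ht in
lemma keptArcs_of_neg (hsg : sg t = -1) :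
    keptArcs e d sg m = keptArcs e d sg t ∪ indexArc d '' Set.Ioo t m := by
  have := h.lt
  have := h.one_le
  rw [keptArcs, keptArcs, ← Set.image_union]
  congr 1
  ext i
  have hi := not_isDeleted_of_le (e := e) (d := d) (sg := sg) (t := t) (x := i)
  simp only [Set.mem_ofPred_eq, Set.mem_union, Set.mem_Ico, Set.mem_Ioo, h.isDeleted_iff ht]
  lia

lemma indexArc_injective : Function.Injective (indexArc d) := by
  intro i j hij
  simp only [indexArc] at hij
  split_ifs at hij <;> rw [Prod.mk.injEq] at hij <;> lia

include h ht hsnk in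
lemma keptArcs_of_pos (hsg : sg t = 1) :
    keptArcs e d sg m = keptArcs e d sg t \ {(t - 1, t)} ∪ indexArc d '' Set.Ico t m := by
  have := h.lt
  have ht1 := ht.1
  have hpred : indexArc d (t - 1) = (t - 1, t) := by
    rw [indexArc, if_pos (dir_pred_of_isSinkIndex ht hsnk), Nat.sub_add_cancel h.one_le]
  rw [keptArcs, keptArcs, ← hpred, ← Set.image_singleton, ← Set.image_sdiff indexArc_injective,
    ← Set.image_union]
  congr 1
  ext i
  have hi := not_isDeleted_of_le (e := e) (d := d) (sg := sg) (t := t) (x := i)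
  simp only [Set.mem_ofPred_eq, Set.mem_union, Set.mem_Ico, Set.mem_sdiff, Set.mem_singleton_iff,
    h.isDeleted_iff ht]
  lia

include h ht hsnk in
lemma straightenedIndexArcs_of_neg (hsg : sg t = -1)
    (hx : IsLeast (laterIndices e d sg (IsSinkIndex e d) (IsSourceIndex e d) t) x) :
    straightenedIndexArcs e d sg m =
      indexArc d '' Set.Ioo t m ∪ insert (t + 1, x) (straightenedIndexArcs e d sg t) := by
  rw [straightenedIndexArcs, h.externalArcsAt_union ht, keptArcs_of_neg h ht hsg,
    externalArcsAt_of_isSinkIndex ht hsnk (.inr ⟨hsg, hx⟩), otherEnd, if_neg (by lia),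
    straightenedIndexArcs]
  ext
  simp only [Set.mem_union, Set.mem_insert_iff, Set.mem_singleton_iff]
  tauto

include ht hsnk in
lemma notMem_externalArcsAt (hx : x < t) : (t - 1, t) ∉ externalArcsAt e d sg x := by
  have ht1 := ht.1
  have hte := ht.2.1
  rintro ⟨s, ⟨hsrc, hs, hq⟩ | ⟨-, hs, hq⟩⟩ <;> rw [Prod.mk.injEq] at hq
  · have hsx : s = x := by
      have hother := hq.2
      rw [otherEnd] at hother
      split_ifs at hother <;> lia
    exact not_isSourceIndex (by lia) (hsx ▸ hs.opp) hsrc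
  · exact not_isSourceIndex (ht1.trans hte) hsnk (hq.2 ▸ hs.opp)

include h ht hsnk in
lemma straightenedIndexArcs_of_pos (hsg : sg t = 1) :
    straightenedIndexArcs e d sg m =
      straightenedIndexArcs e d sg t \ {(t - 1, t)} ∪
        insert (t - 1, m) (insert (t + 1, t) (indexArc d '' Set.Ioo t m)) := by
  have hd := not_dir_of_isSinkIndex ht hsnk
  have hold : {q | ∃ r < t, IsTurn e d r ∧ q ∈ externalArcsAt e d sg r} \ {(t - 1, t)} =
      {q | ∃ r < t, IsTurn e d r ∧ q ∈ externalArcsAt e d sg r} :=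
    Set.sdiff_singleton_eq_self fun ⟨r, hr, _, hq⟩ => notMem_externalArcsAt ht hsnk hr hq
  rw [straightenedIndexArcs, h.externalArcsAt_union ht, keptArcs_of_pos h ht hsnk hsg,
    externalArcsAt_of_isSinkIndex ht hsnk (.inl ⟨hsg, h.isLeast_isSourceIndex hd⟩), otherEnd,
    if_pos hsg, straightenedIndexArcs, Set.union_sdiff_distrib, hold,
    ← Set.Ioo_insert_left h.lt, Set.image_insert_eq, indexArc, if_neg hd]
  ext
  simp only [Set.mem_union, Set.mem_insert_iff, Set.mem_singleton_iff]
  tauto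

include ht hsnk in
lemma mem_straightenedIndexArcs (hcol : IsTurn e d (t - 1) → sg (t - 1) ≠ -1) :
    (t - 1, t) ∈ straightenedIndexArcs e d sg t := by
  have ht1 := ht.1
  refine .inl ⟨t - 1, ⟨⟨by lia, by lia⟩, ?_⟩, ?_⟩
  · rintro ⟨r, hr, hturn, ⟨-, hrt⟩ | ⟨hsg, rfl⟩⟩
    · lia
    · exact hcol hturn hsg
  · rw [indexArc, if_pos (dir_pred_of_isSinkIndex ht hsnk), Nat.sub_add_cancel ht1.le]

include h ht hsnk in
lemma IsStraightening.extend_of_neg (hsg : sg t = -1) (hl : IsStraightening e d sg t l) :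
    IsStraightening e d sg m (descent t m ++ l) := by
  have hd := not_dir_of_isSinkIndex ht hsnk
  have hlt := h.lt
  obtain ⟨x, hxl, hx⟩ := hl.head
  refine ⟨nodup_descent_append hl, mem_descent_append hl hlt, ?_, ⟨m, ?_, ?_⟩, ?_⟩
  · rw [listArcs_append (getLast?_descent hlt) hxl, hl.listArcs_eq, listArcs_descent hlt,
      straightenedIndexArcs_of_neg h ht hsnk hsg hx]
    exact fun i hi => mt (h.dir_iff ⟨hi.1.le, hi.2⟩).1 hd
  · rw [List.head?_append]
    simp [Option.mem_def.1 (head?_descent hlt)]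
  · exact ⟨⟨h.isSourceIndex hd, fun r hr _ _ _ => hr⟩,
      fun s hs => h.le_of_isSourceIndex hs.1 (hs.2 t hlt ht hsnk hsg)⟩
  · obtain ⟨k, hkl, hk⟩ := hl.last
    refine ⟨k, ?_, ?_⟩
    · rw [List.getLast?_append]
      simp [Option.mem_def.1 hkl]
    · rwa [h.laterIndices_eq fun hsrc => absurd hsrc (not_isSourceIndex (ht.1.trans ht.2.1) hsnk)]

include h ht hsnk in
lemma IsStraightening.exists_extend_of_pos (hcol : IsTurn e d (t - 1) → sg (t - 1) ≠ -1)
    (hsg : sg t = 1) (hl : IsStraightening e d sg t l) : ∃ l', IsStraightening e d sg m l' := by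
  have hd := not_dir_of_isSinkIndex ht hsnk
  have hlt := h.lt
  obtain ⟨l₁, l₂, rfl, h₁, h₂⟩ :=
    exists_append_of_mem_listArcs (hl.listArcs_eq ▸ mem_straightenedIndexArcs ht hsnk hcol)
  have hperm : (l₁ ++ (descent t m ++ l₂)).Perm (descent t m ++ (l₁ ++ l₂)) := by
    simp only [← List.append_assoc]
    exact List.perm_append_comm.append_right l₂
  refine ⟨l₁ ++ (descent t m ++ l₂), hperm.nodup_iff.2 (nodup_descent_append hl),
    fun x => hperm.mem_iff.trans (mem_descent_append hl hlt x), ?_, ?_, ?_⟩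
  · rw [listArcs_insert hl.nodup h₁ h₂ (head?_descent hlt) (getLast?_descent hlt), hl.listArcs_eq,
      listArcs_descent hlt, straightenedIndexArcs_of_pos h ht hsnk hsg]
    exact fun i hi => mt (h.dir_iff ⟨hi.1.le, hi.2⟩).1 hd
  · obtain ⟨x, hxl, hx⟩ := hl.head
    refine ⟨x, ?_, by rwa [h.laterIndices_eq fun _ => by lia]⟩
    have hne : l₁ ≠ [] := by rintro rfl; simp at h₁
    rwa [List.head?_append_of_ne_nil _ hne] at hxl ⊢
  · obtain ⟨k, hkl, hk⟩ := hl.last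
    have hsrc : ¬ IsSourceIndex e d t := not_isSourceIndex (ht.1.trans ht.2.1) hsnk
    refine ⟨k, ?_, by rwa [h.laterIndices_eq fun h => absurd h hsrc]⟩
    have hne : l₂ ≠ [] := by rintro rfl; simp at h₂
    rw [List.getLast?_append_of_ne_nil _ hne] at hkl
    rwa [← List.append_assoc, List.getLast?_append_of_ne_nil _ hne]

end Extension

lemma IsNextTurn.isStraightening (h : IsNextTurn e d 1 m) (hd : d 1) :
    IsStraightening e d sg m (List.range' 1 m) := by
  have hm := h.lt
  have hturn (r : ℕ) (hr : r < m) : ¬ IsTurn e d r := fun hr' => by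
    have := h.le_of_isTurn hr' hr
    have := hr'.1
    lia
  have hlater {same opp : ℕ → Prop} {s : ℕ} (hs : opp s) : s ∈ laterIndices e d sg same opp m :=
    ⟨hs, fun r hr hr' => absurd hr' (hturn r hr)⟩
  have hdir (i : ℕ) (hi : i ∈ Set.Ico 1 m) : d i := (h.dir_iff hi).2 hd
  refine ⟨List.nodup_range', fun x => by rw [List.mem_range'_1, Set.mem_Icc]; lia, ?_,
    ⟨1, ?_, hlater ⟨.inl rfl, fun _ => hd, by lia⟩, ?_⟩,
    ⟨m, ?_, hlater (h.compl.isSourceIndex (not_not.2 hd)), ?_⟩⟩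
  · have hexternal : {q | ∃ r < m, IsTurn e d r ∧ q ∈ externalArcsAt e d sg r} = ∅ :=
      Set.eq_empty_of_forall_notMem fun q ⟨r, hr, hr', _⟩ => hturn r hr hr'
    have hkept : {i ∈ Set.Ico 1 m | ¬ IsDeleted e d sg m i} = Set.Ico 1 m :=
      Set.sep_eq_self_iff_mem_true.2 fun i _ ⟨r, hr, hr', _⟩ => hturn r hr hr'
    rw [straightenedIndexArcs, hexternal, Set.union_empty, keptArcs, hkept, listArcs_range',
      Nat.add_sub_cancel_left]
    exact Set.image_congr fun i hi => by rw [indexArc, if_pos (hdir i hi)]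
  · rw [List.head?_range', if_neg (by lia), Option.mem_some_iff]
  · rintro s ⟨⟨hs | hs | hs, -⟩, -⟩
    · exact hs.ge
    · exact hs ▸ hm.le.trans h.le
    · exact hs.1.le
  · rw [List.getLast?_range', if_neg (by lia), Option.mem_some_iff]
    lia
  · rintro s ⟨hs, -⟩
    refine h.compl.le_of_isSourceIndex hs ?_
    have hs1 : s ≠ 1 := by
      rintro rfl
      exact hs.2.1 (hm.trans_le h.le) hd
    rcases hs.1 with hs | hs | hs
    · exact absurd hs hs1
    · exact hs ▸ hm.trans_le h.le
    · exact hs.1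

lemma exists_isNextTurn (hm : 1 < m) (hme : m ≤ e) (hmt : m = e ∨ IsTurn e d m) :
    ∃ t, IsNextTurn e d t m ∧ (t = 1 ∨ IsTurn e d t) := by
  set s := {t | t < m ∧ (t = 1 ∨ IsTurn e d t)}
  have hne : s.Nonempty := ⟨1, hm, .inl rfl⟩
  have hbdd : BddAbove s := ⟨m, fun t ht => ht.1.le⟩
  obtain ⟨htm, ht⟩ := Nat.sSup_mem hne hbdd
  refine ⟨_, ⟨?_, htm, hme, hmt, fun x hx hxm hxt => ?_⟩, ht⟩
  · exact ht.elim Eq.ge fun ht => ht.1.le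
  · exact (le_csSup hbdd ⟨hxm, .inr hxt⟩).not_gt hx

lemma IsNextTurn.exists_extend (h : IsNextTurn e d t m) (ht : IsTurn e d t)
    (hsg : sg t = 1 ∨ sg t = -1) (hcol : IsTurn e d (t - 1) → sg t = 1 → sg (t - 1) ≠ -1)
    (hl : IsStraightening e d sg t l) : ∃ l', IsStraightening e d sg m l' := by
  wlog hd : ¬ d t generalizing d l
  · obtain ⟨l', hl'⟩ := this h.compl (isTurn_compl.2 ht) (by rwa [isTurn_compl]) hl.reverse hd
    exact ⟨_, compl_compl d ▸ hl'.reverse⟩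
  have hsnk : IsSinkIndex e d t :=
    ⟨.inr (.inr (isTurn_compl.2 ht)), fun _ => hd, fun _ hd' => ht.2.2 (iff_of_false hd' hd)⟩
  rcases hsg with hsg | hsg
  · exact hl.exists_extend_of_pos h ht hsnk (fun h => hcol h hsg) hsg
  · exact ⟨_, hl.extend_of_neg h ht hsnk hsg⟩

lemma exists_isStraightening (hsg : ∀ t, IsTurn e d t → sg t = 1 ∨ sg t = -1)
    (hcol : ∀ t, IsTurn e d t → IsTurn e d (t + 1) → ¬ (sg t = -1 ∧ sg (t + 1) = 1))
    (hm : 1 < m) (hme : m ≤ e) (hmt : m = e ∨ IsTurn e d m) :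
    ∃ l, IsStraightening e d sg m l := by
  induction m using Nat.strong_induction_on with
  | _ m ih =>
    obtain ⟨t, h, rfl | ht⟩ := exists_isNextTurn hm hme hmt
    · by_cases hd : d 1
      · exact ⟨_, h.isStraightening hd⟩
      · exact ⟨_, compl_compl d ▸ (h.compl.isStraightening hd).reverse⟩
    · obtain ⟨l, hl⟩ := ih t h.lt ht.1 ht.2.1.le (.inr ht)
      refine h.exists_extend ht (hsg t ht) (fun ht' ht1 ht2 => ?_) hl
      have hpred : t - 1 + 1 = t := Nat.sub_add_cancel h.one_le
      exact hcol (t - 1) ht' (hpred.symm ▸ ht) ⟨ht2, hpred.symm ▸ ht1⟩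

end IndexStraightening

/-! ### The enumeration of an edge -/

/-- The direction of the arcs of `S` on the side `s`: an arc of `σ s` joining `x` and `y` points to
`y`. -/
def Before : Side → ℤ → ℤ → Prop
  | .above, x, y => x < y
  | .below, x, y => y < x

lemma mem_S_iff {σ : Side → Equiv.Perm ℤ} {x y : ℤ} :
    (x, y) ∈ S σ ↔ ∃ s, σ s x = y ∧ Before s x y := by
  constructor
  · rintro (⟨h, h'⟩ | ⟨h, h'⟩)
    exacts [⟨.above, h', h⟩, ⟨.below, h', h⟩]
  · rintro ⟨_ | _, h', h⟩
    exacts [.inl ⟨h, h'⟩, .inr ⟨h, h'⟩]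

lemma Before.ne {s : Side} {x y : ℤ} (h : Before s x y) : x ≠ y := by
  cases s
  exacts [LT.lt.ne h, LT.lt.ne' h]

lemma before_comm {s : Side} {x y : ℤ} (h : x ≠ y) : Before s y x ↔ ¬ Before s x y := by
  cases s <;> simp only [Before] <;> lia

lemma Side.eq_or_eq_flip (s t : Side) : s = t ∨ s = t.flip := by
  cases s <;> cases t <;> simp [Side.flip]

lemma Side.flip_flip (s : Side) : s.flip.flip = s := by cases s <;> rfl

lemma zpow_apply_eq_iff {α : Type*} {ρ : Equiv.Perm α} {x : α} {i j : ℤ} :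
    (ρ ^ i) x = (ρ ^ j) x ↔
      ((MulAction.orbit (Subgroup.zpowers ρ) x).ncard : ℤ) ∣ i - j := by
  have hper : (MulAction.orbit (Subgroup.zpowers ρ) x).ncard =
      Function.minimalPeriod (ρ • ·) x := by
    rw [← Nat.card_coe_set_eq, Nat.card_congr (MulAction.orbitZPowersEquiv ρ x), Nat.card_zmod]
  rw [hper, ← MulAction.zpow_smul_eq_iff_minimalPeriod_dvd, sub_eq_neg_add, zpow_add, zpow_neg,
    mul_smul, inv_smul_eq_iff]
  rfl

/-- The sequence `0, 0, 1, -1, 2, -2, ...` of the powers of the product of the two involutions that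
carry the starting point `a` to the points `φ(0), φ(1), φ(2), ...`. -/
def zigzag (t : ℕ) : ℤ := if t % 2 = 0 then (t / 2 : ℕ) else -(t / 2 : ℕ)

section Enumeration

variable {σ : Side → Equiv.Perm ℤ} {E : Set ℤ} {a : ℤ}

lemma arcSide_mod_two (t : ℕ) : arcSide σ a (t % 2) = arcSide σ a t := by
  induction t using Nat.twoStepInduction with
  | zero => rfl
  | one => rfl
  | more t ih _ => rw [Nat.add_mod_right, ih]; exact (Side.flip_flip _).symm

lemma apply_phi_zero (ha : ∃ s, σ s a = a) : σ (arcSide σ a 0) a = a := by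
  rw [arcSide]
  split_ifs with h
  · exact h
  · obtain ⟨_ | _, hs⟩ := ha
    exacts [absurd hs h, hs]

lemma phi_succ (ha : ∃ s, σ s a = a) (t : ℕ) :
    phi σ a (t + 1) = σ (arcSide σ a t) (phi σ a t) := by
  cases t with
  | zero => exact (apply_phi_zero ha).symm
  | succ t => rfl

lemma phi_eq_zpow (hσ : ∀ s, Function.Involutive (σ s)) (ha : ∃ s, σ s a = a) (t : ℕ) :
    phi σ a t = ((σ (arcSide σ a 1) * σ (arcSide σ a 0)) ^ zigzag t) a := by
  have hfix := apply_phi_zero ha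
  induction t with
  | zero => rfl
  | succ t ih =>
    rw [phi_succ ha, ih, ← arcSide_mod_two]
    rcases Nat.mod_two_eq_zero_or_one t with h | h <;> rw [h]
    · have hz : zigzag (t + 1) = -zigzag t := by
        unfold zigzag; split_ifs <;> lia
      rw [right_apply_zpow (hσ _) (hσ _), hfix, hz]
    · have hz : zigzag (t + 1) = -zigzag t + 1 := by
        unfold zigzag; split_ifs <;> lia
      rw [left_apply_zpow (hσ _) (hσ _), hz, zpow_add_one, Equiv.Perm.mul_apply,
        Equiv.Perm.mul_apply, hfix]

/-- `φ` enumerates the `e` points of the edge `E` starting from its end-point `a`. -/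
structure IsEnumeration (σ : Side → Equiv.Perm ℤ) (E : Set ℤ) (a : ℤ) (e : ℕ) : Prop where
  involutive : ∀ s, Function.Involutive (σ s)
  one_lt : 1 < e
  injOn : Set.InjOn (phi σ a) (Set.Icc 1 e)
  image : phi σ a '' Set.Icc 1 e = E
  last : phi σ a (e + 1) = phi σ a e
  exists_fixed : ∃ s, σ s a = a

lemma IsEdge.eq_orbit_zpowers (hσ : ∀ s, Function.Involutive (σ s))
    (hE : IsEdge (σ .above) (σ .below) E) (ha : IsEdgeEnd σ E a) :
    E = MulAction.orbit (Subgroup.zpowers (σ (arcSide σ a 1) * σ (arcSide σ a 0))) a := by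
  rw [← orbit_closure_pair_eq_of_fixed (hσ _) (hσ _) (.inr (apply_phi_zero ha.2)),
    hE.isMeander.eq_orbit ha.1, show arcSide σ a 1 = (arcSide σ a 0).flip from rfl]
  cases arcSide σ a 0
  exacts [by rw [Set.pair_comm]; rfl, rfl]

lemma isEnumeration (hσ : ∀ s, Function.Involutive (σ s)) (hfin : E.Finite)
    (hE : IsEdge (σ .above) (σ .below) E) (hnt : E.Nontrivial) (ha : IsEdgeEnd σ E a) :
    IsEnumeration σ E a E.ncard := by
  have horbit := hE.eq_orbit_zpowers hσ ha
  have hφ := phi_eq_zpow hσ ha.2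
  have hφE (i : ℕ) : phi σ a i ∈ E := by
    rw [hφ, horbit]
    exact mem_orbit_zpowers.2 ⟨_, rfl⟩
  have hphi (i j : ℕ) : phi σ a i = phi σ a j ↔ (E.ncard : ℤ) ∣ zigzag i - zigzag j := by
    rw [hφ, hφ, zpow_apply_eq_iff, ← horbit]
  have hinj : Set.InjOn (phi σ a) (Set.Icc 1 E.ncard) := by
    rintro i ⟨hi, hi'⟩ j ⟨hj, hj'⟩ hij
    have hzz : zigzag i - zigzag j = 0 := by
      refine Int.eq_zero_of_abs_lt_dvd ((hphi i j).1 hij) (abs_lt.2 ?_)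
      unfold zigzag; split_ifs <;> lia
    unfold zigzag at hzz; split_ifs at hzz <;> lia
  refine ⟨hσ, (Set.one_lt_ncard_iff_nontrivial_and_finite.2 ⟨hnt, hfin⟩), hinj, ?_, ?_, ha.2⟩
  · refine Set.eq_of_subset_of_ncard_le (Set.image_subset_iff.2 fun i _ => hφE i) ?_ hfin
    rw [hinj.ncard_image, ← Finset.coe_Icc, Set.ncard_coe_finset, Nat.card_Icc,
      Nat.add_sub_cancel]
  · rw [hphi]
    rcases Nat.mod_two_eq_zero_or_one E.ncard with h | h
    · exact ⟨-1, by unfold zigzag; split_ifs <;> lia⟩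
    · exact ⟨1, by unfold zigzag; split_ifs <;> lia⟩

/-- The arc joining `φ(t)` and `φ(t+1)` points to `φ(t+1)`. -/
def Forward (σ : Side → Equiv.Perm ℤ) (a : ℤ) (t : ℕ) : Prop :=
  Before (arcSide σ a t) (phi σ a t) (phi σ a (t + 1))

namespace IsEnumeration

variable {e : ℕ} (N : IsEnumeration σ E a e) {i j t : ℕ}

include N

lemma apply_phi_arcSide (t : ℕ) : σ (arcSide σ a t) (phi σ a t) = phi σ a (t + 1) :=
  (phi_succ N.exists_fixed t).symm

lemma apply_phi_succ (t : ℕ) : σ (arcSide σ a t) (phi σ a (t + 1)) = phi σ a t := by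
  rw [← N.apply_phi_arcSide, N.involutive]

lemma apply_phi (s : Side) (ht : 1 ≤ t) :
    (s = arcSide σ a t ∧ σ s (phi σ a t) = phi σ a (t + 1)) ∨
      (s = arcSide σ a (t - 1) ∧ σ s (phi σ a t) = phi σ a (t - 1)) := by
  obtain ⟨k, rfl⟩ : ∃ k, t = k + 1 := ⟨t - 1, by lia⟩
  rcases Side.eq_or_eq_flip s (arcSide σ a (k + 1)) with rfl | rfl
  · exact .inl ⟨rfl, N.apply_phi_arcSide _⟩
  · rw [arcSide, Side.flip_flip]
    exact .inr ⟨rfl, N.apply_phi_succ k⟩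

lemma phi_inj (hi : i ∈ Set.Icc 1 e) (hj : j ∈ Set.Icc 1 e) : phi σ a i = phi σ a j ↔ i = j :=
  N.injOn.eq_iff hi hj

lemma phi_mem (hi : i ∈ Set.Icc 1 e) : phi σ a i ∈ E := N.image ▸ Set.mem_image_of_mem _ hi

lemma exists_index {x : ℤ} (hx : x ∈ E) : ∃ i ∈ Set.Icc 1 e, phi σ a i = x := by
  rwa [← N.image] at hx

lemma phi_ne_succ (hi : i ∈ Set.Ico 1 e) : phi σ a i ≠ phi σ a (i + 1) := by
  rw [Ne, N.phi_inj ⟨hi.1, hi.2.le⟩ ⟨by lia, hi.2⟩]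
  lia

lemma apply_mem (s : Side) {x : ℤ} (hx : x ∈ E) : σ s x ∈ E := by
  obtain ⟨i, ⟨hi, hi'⟩, rfl⟩ := N.exists_index hx
  rcases N.apply_phi s hi with ⟨-, h⟩ | ⟨-, h⟩ <;> rw [h]
  · rcases eq_or_lt_of_le hi' with rfl | h
    · exact N.last ▸ N.phi_mem ⟨hi, le_rfl⟩
    · exact N.phi_mem ⟨by lia, h⟩
  · rcases eq_or_lt_of_le hi with rfl | h
    · exact N.phi_mem (i := 1) ⟨le_rfl, hi'⟩
    · exact N.phi_mem ⟨by lia, by lia⟩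

lemma eq_one_or_eq_of_fixed {s : Side} (ht : t ∈ Set.Icc 1 e)
    (hs : σ s (phi σ a t) = phi σ a t) : t = 1 ∨ t = e := by
  obtain ⟨h1, he⟩ := ht
  by_contra! hne
  rcases N.apply_phi s h1 with ⟨-, h⟩ | ⟨-, h⟩ <;>
    rw [h, N.phi_inj ⟨by lia, by lia⟩ ⟨h1, he⟩] at hs <;> lia

lemma exists_apply_ne {x : ℤ} (hx : x ∈ E) : ∃ s, σ s x ≠ x := by
  have he := N.one_lt
  obtain ⟨i, ⟨hi, hi'⟩, rfl⟩ := N.exists_index hx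
  rcases eq_or_lt_of_le hi with rfl | hlt
  · exact ⟨_, N.apply_phi_arcSide 1 ▸ (N.phi_ne_succ ⟨le_rfl, he⟩).symm⟩
  · obtain ⟨k, rfl⟩ : ∃ k, i = k + 1 := ⟨i - 1, by lia⟩
    exact ⟨_, N.apply_phi_succ k ▸ N.phi_ne_succ ⟨by lia, hi'⟩⟩

lemma mk_phi_mem_S_iff (hi : i ∈ Set.Icc 1 e) (hj : j ∈ Set.Icc 1 e) :
    (phi σ a i, phi σ a j) ∈ S σ ↔
      (j = i + 1 ∧ Forward σ a i) ∨ (i = j + 1 ∧ ¬ Forward σ a j) := by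
  obtain ⟨hi1, hie⟩ := hi
  rw [mem_S_iff]
  constructor
  · rintro ⟨s, hs, hB⟩
    rcases N.apply_phi s hi1 with ⟨rfl, h⟩ | ⟨rfl, h⟩ <;> rw [← hs, h] at hB <;> rw [h] at hs
    · have hlt : i < e := lt_of_le_of_ne hie (by rintro rfl; exact hB.ne N.last.symm)
      exact .inl ⟨((N.phi_inj ⟨by lia, hlt⟩ hj).1 hs).symm, hB⟩
    · have hlt : 1 < i := lt_of_le_of_ne hi1 (by rintro rfl; exact hB.ne rfl)
      obtain rfl := (N.phi_inj ⟨by lia, by lia⟩ hj).1 hs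
      obtain ⟨k, rfl⟩ : ∃ k, i = k + 1 := ⟨i - 1, by lia⟩
      exact .inr ⟨rfl, (before_comm (N.phi_ne_succ ⟨by lia, hie⟩)).1 hB⟩
  · rintro (⟨rfl, h⟩ | ⟨rfl, h⟩)
    · exact ⟨_, N.apply_phi_arcSide _, h⟩
    · exact ⟨_, N.apply_phi_succ j, (before_comm (N.phi_ne_succ ⟨hj.1, hie⟩)).2 h⟩

lemma mem_of_mem_S {x y : ℤ} (h : (x, y) ∈ S σ) : x ∈ E ↔ y ∈ E := by
  obtain ⟨s, rfl, -⟩ := mem_S_iff.1 h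
  exact ⟨N.apply_mem s, fun hy => N.involutive s x ▸ N.apply_mem s hy⟩

lemma isInternalTurning_iff : IsInternalTurning σ a e t ↔ IsTurn e (Forward σ a) t := by
  refine and_congr_right fun h₁ => and_congr_right fun h₂ => ?_
  obtain ⟨k, rfl⟩ : ∃ k, t = k + 1 := ⟨t - 1, by lia⟩
  rw [Nat.add_sub_cancel]
  have hne := N.phi_ne_succ (i := k) ⟨by lia, by lia⟩
  have hne' := N.phi_ne_succ (i := k + 1) ⟨by lia, h₂⟩
  rw [Forward, Forward, show arcSide σ a (k + 1) = (arcSide σ a k).flip from rfl, mul_neg_iff]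
  cases arcSide σ a k <;> simp only [Side.flip, Before] <;> lia

lemma isTurning_iff :
    IsTurning σ a e t ↔ t = 1 ∨ t = e ∨ IsTurn e (Forward σ a) t := by
  rw [IsTurning, N.isInternalTurning_iff]

lemma mem_Icc_of_isTurning (h : IsTurning σ a e t) : t ∈ Set.Icc 1 e := by
  have he := N.one_lt
  rcases h with rfl | rfl | h
  exacts [⟨le_rfl, he.le⟩, ⟨he.le, le_rfl⟩, ⟨h.1.le, h.2.1.le⟩]

lemma isSource_iff : IsSource σ a e t ↔ IsSourceIndex e (Forward σ a) t := by
  rw [IsSource, IsSourceIndex, ← N.isTurning_iff]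
  refine and_congr_right fun h => ?_
  have ht := N.mem_Icc_of_isTurning h
  refine ⟨fun h' => ⟨fun hlt => ?_, fun hlt hf => ?_⟩, fun ⟨h₁, h₂⟩ y hy => ?_⟩
  · by_contra hf
    exact h' _ ((N.mk_phi_mem_S_iff ⟨by lia, hlt⟩ ht).2 (.inr ⟨rfl, hf⟩))
  · exact h' _ ((N.mk_phi_mem_S_iff ⟨by lia, by have := ht.2; lia⟩ ht).2 (.inl ⟨by lia, hf⟩))
  · obtain ⟨j, hj, rfl⟩ := N.exists_index ((N.mem_of_mem_S hy).2 (N.phi_mem ht))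
    rcases (N.mk_phi_mem_S_iff hj ht).1 hy with ⟨rfl, hf⟩ | ⟨rfl, hf⟩
    exacts [h₂ (Nat.lt_add_one_iff.2 hj.1) hf, hf (h₁ hj.2)]

lemma isSink_iff : IsSink σ a e t ↔ IsSinkIndex e (Forward σ a) t := by
  rw [IsSink, IsSinkIndex, IsSourceIndex, isTurn_compl, ← N.isTurning_iff]
  refine and_congr_right fun h => ?_
  have ht := N.mem_Icc_of_isTurning h
  refine ⟨fun h' => ⟨fun hlt hf => ?_, fun hlt => not_not.2 ?_⟩, fun ⟨h₁, h₂⟩ y hy => ?_⟩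
  · exact h' _ ((N.mk_phi_mem_S_iff ht ⟨by lia, hlt⟩).2 (.inl ⟨rfl, hf⟩))
  · by_contra hf
    exact h' _ ((N.mk_phi_mem_S_iff ht ⟨by lia, by have := ht.2; lia⟩).2 (.inr ⟨by lia, hf⟩))
  · obtain ⟨j, hj, rfl⟩ := N.exists_index ((N.mem_of_mem_S hy).1 (N.phi_mem ht))
    rcases (N.mk_phi_mem_S_iff ht hj).1 hy with ⟨rfl, hf⟩ | ⟨rfl, hf⟩
    exacts [h₁ hj.2 hf, h₂ (Nat.lt_add_one_iff.2 hj.1) hf]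

end IsEnumeration

end Enumeration

/-! ### Aligned edges -/

section AlignedEdge

variable {A : Set (ℤ × ℤ)} {V : Set ℤ} {x y x' y' z : ℤ}

lemma IsAlignedEdge.ne (h : IsAlignedEdge A V x y) : x ≠ y := by
  obtain ⟨p, ψ, hp, hinj, -, -, rfl, rfl⟩ := h
  rw [Ne, hinj.eq_iff ⟨le_rfl, by lia⟩ ⟨by lia, le_rfl⟩]
  lia

lemma IsAlignedEdge.start_mem (h : IsAlignedEdge A V x y) : x ∈ V := by
  obtain ⟨p, ψ, hp, -, rfl, -, rfl, -⟩ := h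
  exact ⟨1, ⟨le_rfl, by lia⟩, rfl⟩

lemma IsAlignedEdge.finish_mem (h : IsAlignedEdge A V x y) : y ∈ V := by
  obtain ⟨p, ψ, hp, -, rfl, -, -, rfl⟩ := h
  exact ⟨p, ⟨by lia, le_rfl⟩, rfl⟩

lemma IsAlignedEdge.eq_start_iff (h : IsAlignedEdge A V x y) (hz : z ∈ V) :
    z = x ↔ ∀ w, (w, z) ∉ A := by
  obtain ⟨p, ψ, hp, hinj, rfl, rfl, rfl, -⟩ := h
  obtain ⟨j, ⟨hj, hjp⟩, rfl⟩ := hz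
  rw [hinj.eq_iff ⟨hj, hjp⟩ ⟨le_rfl, by lia⟩]
  constructor
  · rintro rfl w ⟨i, hi, hip, heq⟩
    have := hinj ⟨le_rfl, hjp⟩ ⟨by lia, hip⟩ (Prod.mk.inj heq).2
    lia
  · intro h
    by_contra hj1
    exact h (ψ (j - 1)) ⟨j - 1, by lia, by lia, by rw [Nat.sub_add_cancel hj]⟩

lemma IsAlignedEdge.eq_finish_iff (h : IsAlignedEdge A V x y) (hz : z ∈ V) :
    z = y ↔ ∀ w, (z, w) ∉ A := by
  obtain ⟨p, ψ, hp, hinj, rfl, rfl, -, rfl⟩ := h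
  obtain ⟨j, ⟨hj, hjp⟩, rfl⟩ := hz
  rw [hinj.eq_iff ⟨hj, hjp⟩ ⟨by lia, le_rfl⟩]
  constructor
  · rintro rfl w ⟨i, hi, hip, heq⟩
    have := hinj ⟨hj, le_rfl⟩ ⟨hi, hip.le⟩ (Prod.mk.inj heq).1
    lia
  · intro h
    by_contra hjp'
    exact h (ψ (j + 1)) ⟨j, hj, by lia, rfl⟩

lemma IsAlignedEdge.unique (h : IsAlignedEdge A V x y) (h' : IsAlignedEdge A V x' y') :
    x = x' ∧ y = y' :=
  ⟨(h'.eq_start_iff h.start_mem).2 ((h.eq_start_iff h.start_mem).1 rfl),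
    (h'.eq_finish_iff h.finish_mem).2 ((h.eq_finish_iff h.finish_mem).1 rfl)⟩

lemma isAlignedEdge_listArcs {l : List ℤ} (hl : l.Nodup) (hx : x ∈ l.head?)
    (hy : y ∈ l.getLast?) (hxy : x ≠ y) : IsAlignedEdge (listArcs l) {z | z ∈ l} x y := by
  have hget (i : ℕ) (hi : i < l.length) : l.getD i 0 = l[i] := by simp [hi]
  rw [Option.mem_def, List.head?_eq_getElem?, List.getElem?_eq_some_iff] at hx
  rw [Option.mem_def, List.getLast?_eq_getElem?, List.getElem?_eq_some_iff] at hy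
  obtain ⟨h0, rfl⟩ := hx
  obtain ⟨hlast, rfl⟩ := hy
  have hlen : 2 ≤ l.length := by
    rw [Ne, hl.getElem_inj_iff] at hxy
    lia
  refine ⟨l.length, fun j => l.getD (j - 1) 0, hlen, ?_, ?_, ?_, hget 0 h0, hget _ hlast⟩
  · rintro i ⟨hi, hi'⟩ j ⟨hj, hj'⟩ hij
    simp only at hij
    rw [hget _ (by lia), hget _ (by lia), hl.getElem_inj_iff] at hij
    lia
  · ext z
    simp only [Set.mem_image, Set.mem_ofPred_eq, List.mem_iff_getElem]
    constructor
    · rintro ⟨j, ⟨hj, hj'⟩, rfl⟩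
      exact ⟨j - 1, by lia, (hget _ (by lia)).symm⟩
    · rintro ⟨i, hi, rfl⟩
      exact ⟨i + 1, ⟨by lia, hi⟩, hget i hi⟩
  · ext q
    rw [mem_listArcs_iff_getElem]
    constructor
    · rintro ⟨i, hi, rfl⟩
      exact ⟨i + 1, by lia, hi, by simp [hi, Nat.lt_of_succ_lt hi]⟩
    · rintro ⟨j, hj, hj', rfl⟩
      obtain ⟨i, rfl⟩ : ∃ i, j = i + 1 := ⟨j - 1, by lia⟩
      exact ⟨i, hj', by simp [hj', Nat.lt_of_succ_lt hj']⟩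

lemma listArcs_map {α β : Type*} (f : α → β) (l : List α) :
    listArcs (l.map f) = Prod.map f f '' listArcs l := by
  ext q
  simp only [mem_listArcs_iff_getElem, Set.mem_image, List.length_map, List.getElem_map]
  constructor
  · rintro ⟨i, hi, rfl⟩
    exact ⟨_, ⟨i, hi, rfl⟩, rfl⟩
  · rintro ⟨_, ⟨i, hi, rfl⟩, rfl⟩
    exact ⟨i, hi, rfl⟩

end AlignedEdge

/-! ### The arcs of the straightened edge -/

section StraightenedArcs

variable {σ : Side → Equiv.Perm ℤ} {E : Set ℤ} {a : ℤ} {e : ℕ} {sg : ℕ → ℤ}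

namespace IsEnumeration

lemma isMarkedValue_iff (N : IsEnumeration σ E a e) {i : ℕ} :
    IsMarkedValue σ a e sg i ↔ IsDeleted e (Forward σ a) sg e i := by
  simp only [IsMarkedValue, IsDeleted, N.isInternalTurning_iff]
  exact exists_congr fun t => ⟨fun h => ⟨h.1.2.1, h⟩, And.right⟩

lemma unmarkedArcs_eq (N : IsEnumeration σ E a e) :
    unmarkedArcs σ a e sg =
      Prod.map (phi σ a) (phi σ a) '' keptArcs e (Forward σ a) sg e := by
  ext q
  simp only [unmarkedArcs, keptArcs, Set.mem_image, Set.mem_ofPred_eq, N.isMarkedValue_iff,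
    exists_exists_and_eq_and]
  constructor
  · rintro ⟨hS, i, hi, hie, hdel, rfl | rfl⟩
    · have h := (N.mk_phi_mem_S_iff ⟨hi, hie.le⟩ ⟨by lia, hie⟩).1 hS
      exact ⟨i, ⟨⟨hi, hie⟩, hdel⟩, by rw [indexArc, if_pos (by grind)]; rfl⟩
    · have h := (N.mk_phi_mem_S_iff ⟨by lia, hie⟩ ⟨hi, hie.le⟩).1 hS
      exact ⟨i, ⟨⟨hi, hie⟩, hdel⟩, by rw [indexArc, if_neg (by grind)]; rfl⟩
  · rintro ⟨i, ⟨⟨hi, hie⟩, hdel⟩, rfl⟩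
    rw [indexArc]
    split_ifs with h
    · exact ⟨(N.mk_phi_mem_S_iff ⟨hi, hie.le⟩ ⟨by lia, hie⟩).2 (.inl ⟨rfl, h⟩),
        i, hi, hie, hdel, .inl rfl⟩
    · exact ⟨(N.mk_phi_mem_S_iff ⟨by lia, hie⟩ ⟨hi, hie.le⟩).2 (.inr ⟨rfl, h⟩),
        i, hi, hie, hdel, .inr rfl⟩

lemma externalArcs_eq (N : IsEnumeration σ E a e) :
    externalArcs σ a e sg = Prod.map (phi σ a) (phi σ a) ''
      {q | ∃ t < e, IsTurn e (Forward σ a) t ∧ q ∈ externalArcsAt e (Forward σ a) sg t} := by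
  have hsource : IsSource σ a e = IsSourceIndex e (Forward σ a) := funext fun _ =>
    propext N.isSource_iff
  have hsink : IsSink σ a e = IsSinkIndex e (Forward σ a) := funext fun _ => propext N.isSink_iff
  have hcross : Crosses σ a e sg = CrossesIndex e (Forward σ a) sg := by
    funext same opp t s
    simp only [Crosses, CrossesIndex, laterIndices, N.isInternalTurning_iff]
  ext q
  simp only [externalArcs, externalArcsAt, hsource, hsink, hcross, N.isInternalTurning_iff,
    Set.mem_ofPred_eq, Set.mem_image]
  constructor
  · rintro ⟨t, s, ht, ⟨htype, hs, rfl⟩ | ⟨htype, hs, rfl⟩⟩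
    · exact ⟨_, ⟨t, ht.2.1, ht, s, .inl ⟨htype, hs, rfl⟩⟩, rfl⟩
    · exact ⟨_, ⟨t, ht.2.1, ht, s, .inr ⟨htype, hs, rfl⟩⟩, rfl⟩
  · rintro ⟨_, ⟨t, -, ht, s, ⟨htype, hs, rfl⟩ | ⟨htype, hs, rfl⟩⟩, rfl⟩
    · exact ⟨t, s, ht, .inl ⟨htype, hs, rfl⟩⟩
    · exact ⟨t, s, ht, .inr ⟨htype, hs, rfl⟩⟩

lemma straightenedArcs_eq (N : IsEnumeration σ E a e) :
    straightenedArcs σ a e sg =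
      Prod.map (phi σ a) (phi σ a) '' straightenedIndexArcs e (Forward σ a) sg e := by
  rw [straightenedArcs, N.unmarkedArcs_eq, N.externalArcs_eq, straightenedIndexArcs,
    Set.image_union]

lemma exists_isAlignedEdge (N : IsEnumeration σ E a e)
    (hsg : ∀ t, IsInternalTurning σ a e t → sg t = 1 ∨ sg t = -1)
    (hcol : ∀ t, IsInternalTurning σ a e t → IsInternalTurning σ a e (t + 1) → sg t = 1) :
    ∃ h k, IsSource σ a e h ∧ IsSink σ a e k ∧
      IsAlignedEdge (straightenedArcs σ a e sg) E (phi σ a h) (phi σ a k) := by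
  simp only [N.isInternalTurning_iff] at hsg hcol
  obtain ⟨l, hl⟩ := exists_isStraightening hsg
    (fun t ht ht' h => absurd (hcol t ht ht') (by lia)) N.one_lt le_rfl (.inl rfl)
  obtain ⟨h, hh, hh_least⟩ := hl.head
  obtain ⟨k, hk, hk_least⟩ := hl.last
  have hsource : IsSourceIndex e (Forward σ a) h := hh_least.1.1
  have hsink : IsSinkIndex e (Forward σ a) k := hk_least.1.1
  refine ⟨h, k, N.isSource_iff.2 hsource, N.isSink_iff.2 hsink, ?_⟩
  have hmem {i : ℕ} (hi : i ∈ l) : i ∈ Set.Icc 1 e := (hl.mem_iff i).1 hi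
  have hne : phi σ a h ≠ phi σ a k := by
    rw [Ne, N.phi_inj (hmem (List.mem_of_mem_head? hh)) (hmem (List.mem_of_mem_getLast? hk))]
    rintro rfl
    exact not_isSourceIndex N.one_lt hsink hsource
  have hnodup : (l.map (phi σ a)).Nodup :=
    hl.nodup.map_on fun i hi j hj => (N.phi_inj (hmem hi) (hmem hj)).1
  have key := isAlignedEdge_listArcs hnodup (List.head?_map ▸ Option.mem_map_of_mem _ hh)
    (List.getLast?_map ▸ Option.mem_map_of_mem _ hk) hne
  have hset : {z | z ∈ l.map (phi σ a)} = E := by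
    rw [← N.image]
    ext z
    simp [hl.mem_iff]
  rwa [listArcs_map, hl.listArcs_eq, ← N.straightenedArcs_eq, hset] at key

end IsEnumeration

end StraightenedArcs

/-! ### The sources and the sinks of an edge -/

section SourcesAndSinks

variable {n : ℕ} {P : Side → Set ℤ} {M : Side → Set (ℤ × ℤ)} {σ : Side → Equiv.Perm ℤ}
  {E : Set ℤ} {a : ℤ} {e : ℕ} {x y : ℤ}

lemma subset_Icc_of_isEdge (L : ∀ s, IsLayer n (P s) (M s) (σ s))
    (hE : IsEdge (σ .above) (σ .below) E) (hnt : E.Nontrivial) : E ⊆ Set.Icc (1 : ℤ) n := by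
  have hinv (s : Side) : Function.Involutive (σ s) := (L s).isModified.involutive
  intro x hx
  by_contra hxn
  have hfixed (s : Side) : ∀ y ∈ ({x} : Set ℤ), σ s y ∈ ({x} : Set ℤ) := by
    rintro y rfl
    exact (L s).isModified.outside y hxn
  have hsub : E ⊆ {x} :=
    hE.isMeander.subset (hinv _) (hinv _) (hfixed _) (hfixed _) hx (Set.mem_singleton x)
  exact hnt.not_subsingleton (Set.subsingleton_singleton.anti hsub)

lemma rRel_of_mem_S (L : ∀ s, IsLayer n (P s) (M s) (σ s)) (hx : x ∈ Set.Icc (1 : ℤ) n)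
    (h : (x, y) ∈ S σ) : RRel P x y := by
  obtain ⟨s, rfl, hB⟩ := mem_S_iff.1 h
  obtain ⟨l, r, hc, hxc⟩ := exists_isComponent (L s).subset hx
  have hyc := (L s).apply_mem hc hxc
  cases s
  · exact .inl ⟨hB, hc.linked.mono hxc.1 hyc.2⟩
  · exact .inr ⟨hB, hc.linked.mono hyc.1 hxc.2⟩

lemma rRel_of_isAlignedEdge (L : ∀ s, IsLayer n (P s) (M s) (σ s)) (hsub : E ⊆ Set.Icc (1 : ℤ) n)
    {A : Set (ℤ × ℤ)} (hA : A ⊆ S σ) (h : IsAlignedEdge A E x y) : RRel P x y := by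
  obtain ⟨p, ψ, hp, hinj, rfl, rfl, rfl, rfl⟩ := h
  have hstep (j : ℕ) (hj : 1 ≤ j) (hjp : j < p) : RRel P (ψ j) (ψ (j + 1)) :=
    rRel_of_mem_S L (hsub ⟨j, ⟨hj, hjp.le⟩, rfl⟩) (hA ⟨j, hj, hjp, rfl⟩)
  suffices ∀ j, 2 ≤ j → j ≤ p → RRel P (ψ 1) (ψ j) from this p hp le_rfl
  intro j hj
  induction j, hj using Nat.le_induction with
  | base => exact hstep 1 le_rfl
  | succ j hj ih =>
    intro hjp
    refine (ih (by lia)).trans (hstep j (by lia) hjp) ?_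
    rw [Ne, hinj.eq_iff ⟨le_rfl, by lia⟩ ⟨by lia, hjp⟩]
    lia

lemma centre_le_of_source (hM : IsMarking n P M) (L : ∀ s, IsLayer n (P s) (M s) (σ s))
    {l r : Side → ℤ} (hc : ∀ s, IsComponent n (P s) (l s) (r s))
    (hx : ∀ s, x ∈ Set.Icc (l s) (r s)) (hsource : ∀ y, (y, x) ∉ S σ) (hne : ∃ s, σ s x ≠ x) :
    l .below + r .below ≤ l .above + r .above ∧
      (l .below + r .below = l .above + r .above → ∃ s, σ s x = x) := by
  have hle : σ .below x ≤ x := not_lt.1 fun h =>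
    hsource _ (.inr ⟨h, (L _).isModified.involutive x⟩)
  have hle' : x ≤ σ .above x := not_lt.1 fun h =>
    hsource _ (.inl ⟨h, (L _).isModified.involutive x⟩)
  refine centre_le_of_le_of_le (s := .below) (s' := .above) hM L nofun (hc _) (hc _) (hx _) (hx _)
    hle hle' fun heq => ?_
  obtain ⟨_ | _, hs⟩ := hne <;> lia

lemma centre_le_of_sink (hM : IsMarking n P M) (L : ∀ s, IsLayer n (P s) (M s) (σ s))
    {l r : Side → ℤ} (hc : ∀ s, IsComponent n (P s) (l s) (r s))
    (hx : ∀ s, x ∈ Set.Icc (l s) (r s)) (hsink : ∀ y, (x, y) ∉ S σ) (hne : ∃ s, σ s x ≠ x) :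
    l .above + r .above ≤ l .below + r .below ∧
      (l .above + r .above = l .below + r .below → ∃ s, σ s x = x) := by
  have hle : σ .above x ≤ x := not_lt.1 fun h => hsink _ (.inl ⟨h, rfl⟩)
  have hle' : x ≤ σ .below x := not_lt.1 fun h => hsink _ (.inr ⟨h, rfl⟩)
  refine centre_le_of_le_of_le (s := .above) (s' := .below) hM L nofun (hc _) (hc _) (hx _) (hx _)
    hle hle' fun heq => ?_
  obtain ⟨_ | _, hs⟩ := hne <;> lia

lemma IsComponent.eq_or_centre_lt {Q : Set ℤ} {l r l' r' : ℤ} (hc : IsComponent n Q l r)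
    (hc' : IsComponent n Q l' r') (hx : x ∈ Set.Icc l r) (hy : y ∈ Set.Icc l' r') (hxy : x < y) :
    (l = l' ∧ r = r') ∨ l + r < l' + r' := by
  have hlr := hc.2.1
  have hlr' := hc'.2.1
  have hlx := hx.1
  have hyr := hy.2
  by_cases h : l' ≤ r
  · exact .inl (hc.eq_of_mem hc' (x := max l l') ⟨by lia, by lia⟩ ⟨by lia, by lia⟩)
  · exact .inr (by lia)

lemma RRel.concentric {l r l' r' : Side → ℤ} (h : RRel P x y)
    (hc : ∀ s, IsComponent n (P s) (l s) (r s)) (hc' : ∀ s, IsComponent n (P s) (l' s) (r' s))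
    (hx : ∀ s, x ∈ Set.Icc (l s) (r s)) (hy : ∀ s, y ∈ Set.Icc (l' s) (r' s))
    (hxle : l .above + r .above ≤ l .below + r .below)
    (hyle : l' .below + r' .below ≤ l' .above + r' .above) :
    l = l' ∧ r = r' ∧ l .above + r .above = l .below + r .below := by
  suffices (l .above = l' .above ∧ r .above = r' .above) ∧
      l .below = l' .below ∧ r .below = r' .below by
    refine ⟨funext fun s => ?_, funext fun s => ?_, by lia⟩ <;> cases s <;> lia
  rcases h with ⟨hxy, hlink⟩ | ⟨hyx, hlink⟩
  · have hyr := (hc _).le_of_linked (hx _).2 hlink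
    have habove := (hc _).eq_of_mem (hc' _) ⟨(hx .above).1.trans hxy.le, hyr⟩ (hy _)
    have := (hc .below).eq_or_centre_lt (hc' .below) (hx _) (hy _) hxy
    lia
  · have hyl := (hc _).ge_of_linked (hx _).1 hlink
    have hbelow := (hc _).eq_of_mem (hc' _) ⟨hyl, hyx.le.trans (hx .below).2⟩ (hy _)
    have := (hc' .above).eq_or_centre_lt (hc .above) (hy _) (hx _) hyx
    lia

namespace IsEnumeration

lemma eq_or_eq_of_fixed (N : IsEnumeration σ E a e) {z : ℤ} (hx : x ∈ E) (hy : y ∈ E) (hz : z ∈ E)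
    (hxy : x ≠ y) (hxf : ∃ s, σ s x = x) (hyf : ∃ s, σ s y = y) (hzf : ∃ s, σ s z = z) :
    z = x ∨ z = y := by
  have hend {w : ℤ} (hw : w ∈ E) (hwf : ∃ s, σ s w = w) : w = phi σ a 1 ∨ w = phi σ a e := by
    obtain ⟨s, hs⟩ := hwf
    obtain ⟨i, hi, rfl⟩ := N.exists_index hw
    rcases N.eq_one_or_eq_of_fixed hi hs with rfl | rfl
    exacts [.inl rfl, .inr rfl]
  have := hend hx hxf
  have := hend hy hyf
  have := hend hz hzf
  grind

lemma not_rRel (N : IsEnumeration σ E a e) (hM : IsMarking n P M)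
    (L : ∀ s, IsLayer n (P s) (M s) (σ s))
    (hP : P .above ∩ P .below ≠ Set.Icc (1 : ℤ) (n - 1)) (hsub : E ⊆ Set.Icc (1 : ℤ) n)
    (hx : x ∈ E) (hy : y ∈ E) (hxy : x ≠ y) (hsink : ∀ z, (x, z) ∉ S σ)
    (hsource : ∀ z, (z, y) ∉ S σ) : ¬ RRel P x y := by
  intro hR
  choose l r hc hxc using fun s => exists_isComponent (L s).subset (hsub hx)
  choose l' r' hc' hyc using fun s => exists_isComponent (L s).subset (hsub hy)
  obtain ⟨hxle, hxf⟩ := centre_le_of_sink hM L hc hxc hsink (N.exists_apply_ne hx)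
  obtain ⟨hyle, hyf⟩ := centre_le_of_source hM L hc' hyc hsource (N.exists_apply_ne hy)
  obtain ⟨rfl, rfl, hcentre⟩ := hR.concentric hc hc' hxc hyc hxle hyle
  have C : IsConcentric n P M σ E l r (l .above + r .above) :=
    { layer := L
      marking := hM
      subset := hsub
      stable := fun s z hz => N.apply_mem s hz
      component := hc
      centre := fun s => by cases s <;> lia
      fixed := fun s z hz hzf => by
        rcases N.eq_or_eq_of_fixed hx hy hz hxy (hxf hcentre) (hyf hcentre.symm) ⟨s, hzf⟩ with
          rfl | rfl
        exacts [hxc s, hyc s] }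
  exact hP (C.inter_eq_Icc ⟨x, hx⟩)

end IsEnumeration

end SourcesAndSinks

/-! ### Adjacent turning points -/

section AdjacentTurns

variable {n : ℕ} {P : Side → Set ℤ} {M : Side → Set (ℤ × ℤ)} {σ : Side → Equiv.Perm ℤ}
  {E : Set ℤ} {a : ℤ} {e t : ℕ} {sg : ℕ → ℤ} {x y : ℤ}

lemma rRel_and_rRel_iff (hxy : x < y) : RRel P x y ∧ RRel P y x ↔ ∀ s, Linked (P s) x y := by
  simp only [RRel, hxy, hxy.not_gt, true_and, false_and, or_false, false_or]
  exact ⟨fun h s => by cases s; exacts [h.1, h.2], fun h => ⟨h _, h _⟩⟩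

/-- Both arcs would cross the centre of the component of `x` and `y`. -/
lemma IsLayer.not_linked {Q : Set ℤ} {M : Set (ℤ × ℤ)} {τ : Equiv.Perm ℤ} (L : IsLayer n Q M τ)
    (hx : x ∈ Set.Icc (1 : ℤ) n) (hxy : x < y) (hτx : τ x < x) (hτy : y < τ y) :
    ¬ Linked Q x y := by
  intro hlink
  obtain ⟨l, r, hc, hxc⟩ := exists_isComponent L.subset hx
  have hyc : y ∈ Set.Icc l r := ⟨hxc.1.trans hxy.le, hc.le_of_linked hxc.2 hlink⟩
  have := L.crosses_centre hc hxc hτx.ne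
  have := L.crosses_centre hc hyc hτy.ne'
  lia

lemma IsEnumeration.isNil_beta (N : IsEnumeration σ E a e) (L : ∀ s, IsLayer n (P s) (M s) (σ s))
    (hsub : E ⊆ Set.Icc (1 : ℤ) n) (ht : IsInternalTurning σ a e t)
    (ht' : IsInternalTurning σ a e (t + 1)) : IsNil n P (beta σ a t) := by
  obtain ⟨h1, hte, hturn⟩ := ht
  obtain ⟨-, hte', hturn'⟩ := ht'
  have hx := hsub (N.phi_mem (i := t) ⟨h1.le, hte.le⟩)
  have hy := hsub (N.phi_mem (i := t + 1) ⟨by lia, hte⟩)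
  have hne := N.phi_ne_succ (i := t) ⟨h1.le, hte⟩
  rw [beta, isNil_root_iff (fun s => (L s).subset) hx hy hne]
  obtain ⟨k, rfl⟩ : ∃ k, t = k + 1 := ⟨t - 1, by lia⟩
  have hσx : σ (arcSide σ a k) (phi σ a (k + 1)) = phi σ a k := N.apply_phi_succ k
  have hσy : σ (arcSide σ a k) (phi σ a (k + 1 + 1)) = phi σ a (k + 1 + 1 + 1) := by
    rw [← N.apply_phi_arcSide (k + 1 + 1)]
    exact congrArg (σ · _) (Side.flip_flip _).symm
  rw [Nat.add_sub_cancel, mul_neg_iff] at hturn hturn'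
  rcases lt_or_gt_of_ne hne with hlt | hlt
  · rw [rRel_and_rRel_iff hlt]
    exact fun h => (L _).not_linked hx hlt (by lia) (by lia) (h (arcSide σ a k))
  · rw [and_comm, rRel_and_rRel_iff hlt]
    exact fun h => (L _).not_linked hy hlt (by lia) (by lia) (h (arcSide σ a k))

lemma IsSignature.eq_one (hsg : IsSignature n P σ a e sg) (ht : IsInternalTurning σ a e t)
    (hnil : IsNil n P (beta σ a t)) : sg t = 1 := by
  by_cases hnil' : IsNil n P (beta σ a (t - 1))
  exacts [(hsg t ht).2.1 hnil' hnil, (hsg t ht).2.2.2 hnil' hnil]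

end AdjacentTurns

end Biparabolic

theorem corollary8p4
    -- the double partition, given by the pair of sets of simple roots, and the standing assumptions
    (n : ℕ) (hn : 1 < n) (P : Biparabolic.Side → Set ℤ)
    (hP : P .above ∪ P .below = Set.Icc (1 : ℤ) (n - 1))
    (hP' : P .above ∩ P .below ≠ Set.Icc (1 : ℤ) (n - 1))
    -- the markings and the modified involutions
    (M : Biparabolic.Side → Set (ℤ × ℤ)) (hM : Biparabolic.IsMarking n P M)
    (σ : Biparabolic.Side → Equiv.Perm ℤ)
    (hσ : ∀ s, Biparabolic.IsModifiedInvolution n (P s) (M s) (σ s))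
    -- a non-trivial edge with a choice of its starting point
    (E : Set ℤ) (hE : Biparabolic.IsEdge (σ .above) (σ .below) E) (hE' : E.Nontrivial)
    (a : ℤ) (ha : Biparabolic.IsEdgeEnd σ E a)
    -- a signature on its internal turning points
    (sg : ℕ → ℤ) (hsg : Biparabolic.IsSignature n P σ a E.ncard sg) :
    (∃ x y, Biparabolic.IsAlignedEdge
      (Biparabolic.straightenedArcs σ a E.ncard sg) E x y) ∧
    ∀ x y, Biparabolic.IsAlignedEdge (Biparabolic.straightenedArcs σ a E.ncard sg) E x y →
      Biparabolic.root x y ∈ -Biparabolic.K n P ∧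
      (Biparabolic.edgeArcs σ E = Biparabolic.straightenedArcs σ a E.ncard sg →
        Biparabolic.root x y ∈ -Biparabolic.K n P ∩ Biparabolic.R n P ∧
        -Biparabolic.K n P ∩ Biparabolic.R n P = -Biparabolic.RStar n P) := by
  open Biparabolic in
  have hQ (s : Side) : P s ⊆ Set.Icc (1 : ℤ) (n - 1) := by
    rw [← hP]
    cases s
    exacts [Set.subset_union_left, Set.subset_union_right]
  have L (s : Side) : IsLayer n (P s) (M s) (σ s) := ⟨hQ s, hM.isHalfArc s, hσ s⟩
  have hsub := subset_Icc_of_isEdge L hE hE'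
  have N := isEnumeration (fun s => (hσ s).involutive) ((Set.finite_Icc _ _).subset hsub) hE hE' ha
  obtain ⟨h, k, hsource, hsink, haligned⟩ := N.exists_isAlignedEdge (fun t ht => (hsg t ht).1)
    fun t ht ht' => hsg.eq_one ht (N.isNil_beta L hsub ht ht')
  refine ⟨⟨_, _, haligned⟩, fun x y hxy => ?_⟩
  obtain ⟨hx, hy, hne⟩ := And.intro hxy.start_mem (And.intro hxy.finish_mem hxy.ne)
  obtain ⟨rfl, rfl⟩ := hxy.unique haligned
  have hK : root _ _ ∈ -K n P := (root_mem_neg_K_iff hQ (hsub hx) (hsub hy) hne).2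
    (N.not_rRel hM L hP' hsub hy hx hne.symm hsink.2 hsource.2)
  refine ⟨hK, fun hEq => ⟨⟨hK, ?_⟩, neg_K_inter_R n P⟩⟩
  rw [root_mem_R_iff hQ (hsub hx) (hsub hy) hne]
  exact rRel_of_isAlignedEdge L hsub (hEq ▸ Set.sep_subset _ _) hxy
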